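/- Let $d\ge 1$ and let $\Omega\subset\mathbb{R}^d$ be an open bounded polyhedral set. A mesh $\mathcal M$ of $\Omega$ is a finite partition of $\Omega$ (up to null sets) into nonempty measurable cells $K\subset\overline\Omega$, such that each boundary $\partial K$ is the union $\bigcup_{\sigma\in\mathcal E_K}\sigma$ of a finite set $\mathcal E_K$ of faces. Faces are measurable parts of hyperplanes of positive $(d-1)$-dimensional measure $|\sigma|$, distinct faces of $K$ overlap only in sets of zero $(d-1)$-dimensional measure, and $K$ lies on exactly one side of $\sigma$ near almost every point of $\sigma$; $\boldsymbol n_{K,\sigma}$ denotes the unit normal vector to $\sigma$ outward $K$. Let $\mathcal E=\bigcup_{K}\mathcal E_K$, and let $\mathcal E_{\rm int}$ be the set of faces common to two distinct cells $K$ and $L$, written $\sigma=K|L$; the faces in $\mathcal E\setminus\mathcal E_{\rm int}$ are contained in $\partial\Omega$. The mesh size $h_{\mathcal M}$ is the maximum of the diameters of the cells. Each mesh comes with points $\boldsymbol x_K\in K$, $K\in\mathcal M$, and with a dual mesh, that is, a partition (up to null sets) of $\Omega$ into measurable sets $(D_\sigma)_{\sigma\in\mathcal E}$ such that, for $\sigma=K|L$,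 $D_\sigma\subset \overline K\cup \overline L$ and the Lebesgue measure $|D_\sigma|$ is positive. Set $$\theta^\nabla_{\mathcal M}=\max_{\sigma\in\mathcal E_{\rm int},\,\sigma=K|L}\frac{|\sigma|\,|\boldsymbol x_L-\boldsymbol x_K|}{|D_\sigma|}$$ (equal to $0$ if $\mathcal E_{\rm int}=\emptyset$). For $\varphi\in C_c^\infty(\Omega)$, let $\nabla_{\mathcal E}\varphi$ be the piecewise constant function equal on each $D_\sigma$, $\sigma\in\mathcal E$, to $$(\nabla_{\mathcal E}\varphi)_\sigma=\frac{|\sigma|}{|D_\sigma|}\,\bigl(\varphi(\boldsymbol x_L)-\varphi(\boldsymbol x_K)\bigr)\,\boldsymbol n_{K,\sigma}\ \text{ if }\sigma\in\mathcal E_{\rm int},\ \sigma=K|L,\qquad (\nabla_{\mathcal E}\varphi)_\sigma=0\ \text{ if }\sigma\in\mathcal E\setminus\mathcal E_{\rm int}.$$ Let $(\mathcal M^{(m)})_{m\in\mathbb N}$ be a sequence of such meshes of $\Omega$ with $h_{\mathcal M^{(m)}}\to0$ as $m\to+\infty$, and suppose that there is $\theta^\nabla\in\mathbb R_+$ with $\theta^\nabla_{\mathcal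 M^{(m)}}\le\theta^\nabla$ for all $m\in\mathbb N$. Let $\varphi\in C_c^\infty(\Omega)$. Then the sequence $(\nabla_{\mathcal E^{(m)}}\varphi)_{m\in\mathbb N}$ is bounded in $L^\infty(\Omega)^d$ uniformly with respect to $m$, and it converges to $\nabla\varphi$ weak-$\star$ in $L^\infty(\Omega)^d$, i.e. for every $\boldsymbol\psi\in L^1(\Omega)^d$, $$\lim_{m\to+\infty}\int_\Omega\nabla_{\mathcal E^{(m)}}\varphi\cdot\boldsymbol\psi\,\mathrm d\boldsymbol x=\int_\Omega\nabla\varphi\cdot\boldsymbol\psi\,\mathrm d\boldsymbol x .$$ -/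

import Mathlib

open MeasureTheory Filter Topology
open scoped ContDiff

noncomputable section

namespace WeakGradient

/-- The Euclidean space of dimension `d`. -/
abbrev Eu (d : ℕ) : Type := EuclideanSpace ℝ (Fin d)

/-- The `(d-1)`-dimensional Lebesgue measure `|σ|` of a subset `σ` of a hyperplane: the
`(d-1)`-dimensional Hausdorff measure, normalized so as to agree with Lebesgue measure on every
hyperplane (for `d = 1` it is the counting measure). -/
def faceMeasure {d : ℕ} (σ : Set (Eu d)) : ℝ :=
  (Measure.euclideanHausdorffMeasure (X := Eu d) (d - 1)).real σ

/-- Open bounded polyhedral sets: the boundary is contained in finitely many hyperplanes. -/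
structure IsPolyhedralDomain {d : ℕ} (Ω : Set (Eu d)) : Prop where
  isOpen : IsOpen Ω
  isBounded : Bornology.IsBounded Ω
  frontier_subset : ∃ H : Finset (Eu d × ℝ), (∀ p ∈ H, p.1 ≠ 0) ∧
    frontier Ω ⊆ ⋃ p ∈ H, {x | inner ℝ p.1 x = p.2}

/-- `n` is the unit normal vector to the flat face `σ`, outward the cell `K`: `σ` is part of a
hyperplane orthogonal to `n` and, near almost every point of `σ`, the set `K` fills the side
of this hyperplane opposite to `n` and does not meet the side towards which `n` points. -/
structure IsOutwardUnitNormal {d : ℕ} (K σ : Set (Eu d)) (n : Eu d) : Prop where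
  norm_eq_one : ‖n‖ = 1
  flat : ∃ c : ℝ, ∀ x ∈ σ, inner ℝ n x = c
  outward : ∀ᵐ x ∂((Measure.euclideanHausdorffMeasure (X := Eu d) (d - 1)).restrict σ),
    ∃ ε > 0, (∀ y ∈ Metric.ball x ε, inner ℝ n (y - x) < 0 → y ∈ K) ∧
      (∀ y ∈ Metric.ball x ε, 0 < inner ℝ n (y - x) → y ∉ K)

/-- A mesh: a finite polyhedral partition of `Ω` (up to Lebesgue-null sets, so that cells may be
taken open, closed, or neither), with the faces of the cells and their outward normals.
A face shared by two cells is the same element of both `faces K` and `faces L`. -/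
structure PolyhedralMesh {d : ℕ} (Ω : Set (Eu d)) where
  /-- The set `ℳ` of cells. -/
  cells : Finset (Set (Eu d))
  /-- The set `ℰ_K` of the faces of the cell `K`. -/
  faces : Set (Eu d) → Finset (Set (Eu d))
  /-- The vector `n_{K,σ}`. -/
  normal : Set (Eu d) → Set (Eu d) → Eu d
  measurableSet_cell : ∀ K ∈ cells, MeasurableSet K
  cell_nonempty : ∀ K ∈ cells, K.Nonempty
  cell_subset : ∀ K ∈ cells, K ⊆ closure Ω
  cells_disjoint : ∀ K ∈ cells, ∀ L ∈ cells, K ≠ L → volume (K ∩ L) = 0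
  cells_cover : volume (Ω \ ⋃ K ∈ cells, K) = 0
  measurableSet_face : ∀ K ∈ cells, ∀ σ ∈ faces K, MeasurableSet σ
  face_pos : ∀ K ∈ cells, ∀ σ ∈ faces K, 0 < faceMeasure σ
  frontier_cell : ∀ K ∈ cells, frontier K = ⋃ σ ∈ faces K, σ
  faces_disjoint : ∀ K ∈ cells, ∀ σ ∈ faces K, ∀ τ ∈ faces K, σ ≠ τ → faceMeasure (σ ∩ τ) = 0
  normal_spec : ∀ K ∈ cells, ∀ σ ∈ faces K, IsOutwardUnitNormal K σ (normal K σ)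
  /-- A face which is not shared by two cells is located on the boundary of `Ω`. -/
  exterior_face : ∀ K ∈ cells, ∀ σ ∈ faces K, (∀ L ∈ cells, σ ∈ faces L → L = K) →
    σ ⊆ frontier Ω

namespace PolyhedralMesh

variable {d : ℕ} {Ω : Set (Eu d)} (M : PolyhedralMesh Ω)

open scoped Classical in
/-- The set `ℰ` of all the faces of the mesh. -/
def allFaces : Finset (Set (Eu d)) := M.cells.biUnion M.faces

/-- `σ = K|L`: the face `σ` is common to the distinct cells `K` and `L`. -/
def Separates (σ K L : Set (Eu d)) : Prop :=
  K ∈ M.cells ∧ L ∈ M.cells ∧ K ≠ L ∧ σ ∈ M.faces K ∧ σ ∈ M.faces L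

/-- `σ ∈ ℰ_int`. -/
def IsInterior (σ : Set (Eu d)) : Prop := ∃ K L, M.Separates σ K L

/-- The mesh size `h_ℳ`, the maximum of the diameters of the cells. -/
def size : ℝ := ⨆ K : M.cells, Metric.diam (K : Set (Eu d))

/-- A dual mesh: a partition of `Ω` (up to Lebesgue-null sets) indexed by the faces, in which the
dual cell of `σ = K|L` is a set of positive measure contained in the union of `K` and `L`. -/
structure DualMesh where
  /-- The dual cell `D_σ`. -/
  dualCell : Set (Eu d) → Set (Eu d)
  measurableSet_dualCell : ∀ σ ∈ M.allFaces, MeasurableSet (dualCell σ)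
  dualCells_disjoint : ∀ σ ∈ M.allFaces, ∀ τ ∈ M.allFaces, σ ≠ τ →
    volume (dualCell σ ∩ dualCell τ) = 0
  dualCells_cover : (⋃ σ ∈ M.allFaces, dualCell σ) =ᵐ[volume] Ω
  dualCell_subset : ∀ σ K L, M.Separates σ K L → dualCell σ ⊆ closure K ∪ closure L
  dualCell_pos : ∀ σ, M.IsInterior σ → 0 < volume (dualCell σ)

end PolyhedralMesh

open PolyhedralMesh

variable {d : ℕ} {Ω : Set (Eu d)} {M : PolyhedralMesh Ω}

open scoped Classical in
/-- The value `(∇_ℰ φ)_σ` of the discrete gradient: `(|σ| / |D_σ|) (φ(x_L) - φ(x_K)) n_{K,σ}` for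
an interior face `σ = K|L`, and `0` for an exterior face. The value does not depend on which of the
two cells is called `K`, since `n_{L,σ} = - n_{K,σ}`. -/
def faceGradient (D : DualMesh M) (x : Set (Eu d) → Eu d) (φ : Eu d → ℝ) (σ : Set (Eu d)) : Eu d :=
  if h : M.IsInterior σ then
    let K := h.choose
    let L := h.choose_spec.choose
    (faceMeasure σ / volume.real (D.dualCell σ) * (φ (x L) - φ (x K))) • M.normal K σ
  else 0

/-- The discrete gradient `∇_ℰ φ`, equal to `(∇_ℰ φ)_σ` over `D_σ` for each face `σ`. -/
def discreteGradient (D : DualMesh M) (x : Set (Eu d) → Eu d) (φ : Eu d → ℝ) : Eu d → Eu d :=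
  fun y => ∑ σ ∈ M.allFaces, (D.dualCell σ).indicator (fun _ => faceGradient D x φ σ) y

/-- The regularity parameter: the maximum over the interior faces `σ = K|L` of
`|σ| |x_L - x_K| / |D_σ|` (equal to `0` if there is no interior face). -/
def meshRegularity (D : DualMesh M) (x : Set (Eu d) → Eu d) : ℝ :=
  sSup {r | ∃ σ K L, M.Separates σ K L ∧
    r = faceMeasure σ * ‖x L - x K‖ / volume.real (D.dualCell σ)}

end WeakGradient

end

/-!
The discrete gradients are bounded because `φ` is Lipschitz and the regularity parameter controls
`|σ| |x_L - x_K| / |D_σ|` (`ae_norm_discreteGradient_le`). Hence it suffices to test them against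
a dense subset of `L¹` (`tendsto_integral_inner_of_contDiff`), and by linearity against fields
`g • v` with `g` smooth and compactly supported and `v` a unit vector.

For such a field, the contribution of an interior face `σ = K|L` is
`|σ| (φ(x_L) - φ(x_K)) ⟪n_{K,σ}, v⟫` times the mean of `g` over `D_σ`, and replacing this mean by
the mean over `σ` costs `O(h)` (`abs_setIntegral_inner_discreteGradient_sub_le`). The resulting
sum is rearranged cell by cell (`sum_inner_faceGradient_eq`): the two cells of an interior face
have opposite normals, and `φ(x_K)` vanishes for the cells with a face on `∂Ω` once the mesh is
fine enough. With the divergence theorem on each cell (`integral_fderiv_eq_sum_faces`) it becomes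
`-∑ K, φ(x_K) ∫_K ∂_v g`, which tends to `-∫ φ ∂_v g = ∫ ∂_v φ g`.

The divergence theorem on cells that are merely bounded sets with a piecewise flat boundary is
obtained by integrating a one-dimensional formula (`integral_indicator_deriv_eq_sum`) over the lines
parallel to `v`. Almost every such line avoids the faces parallel to `v`, the intersections of
faces and the exceptional points of faces (`ae_obliqueProj`). The area factor `|⟪n, v⟫|` comes from
writing Lebesgue measure in the coordinates given by the hyperplane of the face and the direction
`v` (`integral_unitWeight_mul_obliqueProj`).
-/

noncomputable section

namespace WeakGradient

/-! ### Piecewise constant functions on the line -/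

/-- A function that is constant on a punctured neighbourhood of every point of the line, with a
constant that may depend on the point, has the same constant everywhere; it is read off at `+∞`. -/
theorem eq_zero_of_eventually_const {q : ℝ → ℝ}
    (hq : ∀ p, ∃ c, ∀ᶠ u in 𝓝[≠] p, q u = c) (htop : ∀ᶠ u in atTop, q u = 0) (p : ℝ) :
    ∀ᶠ u in 𝓝[≠] p, q u = 0 := by
  choose c hc using hq
  have hloc : IsLocallyConstant c := by
    rw [IsLocallyConstant.iff_eventually_eq]
    intro p
    obtain ⟨U, hU, hpU, hUq⟩ := eventually_nhds_iff.1 (eventually_nhdsWithin_iff.1 (hc p)) |>.imp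
      fun U h => (⟨h.2.1, h.2.2, h.1⟩ : IsOpen U ∧ p ∈ U ∧ _)
    filter_upwards [hU.mem_nhds hpU] with y hy
    have h1 : ∀ᶠ u in 𝓝[≠] y, q u = c p := by
      by_cases hyp : y = p
      · rw [hyp]; exact hc p
      · filter_upwards [nhdsWithin_le_nhds (hU.mem_nhds hy),
          nhdsWithin_le_nhds (isOpen_ne.mem_nhds hyp)] with u hu hup
        exact hUq u hu hup
    obtain ⟨u, hu1, hu2⟩ := (h1.and (hc y)).exists
    rw [← hu1, ← hu2]
  obtain ⟨A, hA⟩ := eventually_atTop.1 htop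
  have h0 : c (A + 1) = 0 := by
    have h1 : ∀ᶠ u in 𝓝[≠] (A + 1), q u = 0 := by
      filter_upwards [nhdsWithin_le_nhds (Ioi_mem_nhds (show A < A + 1 by linarith))] with u hu
      exact hA u hu.le
    obtain ⟨u, hu1, hu2⟩ := (h1.and (hc (A + 1))).exists
    rw [← hu1, ← hu2]
  have := hloc.apply_eq_of_isPreconnected isPreconnected_univ (Set.mem_univ p)
    (Set.mem_univ (A + 1))
  rw [← h0, ← this]
  exact hc p

/-- The fundamental theorem of calculus on a set `S` of the line that is bounded above and has
finitely many boundary points `t j`, where `s j` is the drop of the indicator function of `S`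
across `t j`. The indicator function agrees off the points `t j` with `∑ j, s j • 1_{(-∞, t j)}`,
since the difference has no jumps and vanishes near `+∞`. -/
theorem integral_indicator_deriv_eq_sum {ι : Type*} (J : Finset ι) (t s : ι → ℝ) {S : Set ℝ}
    (hinj : Set.InjOn t J) (hfr : ∀ u ∈ frontier S, ∃ j ∈ J, t j = u)
    (hjump : ∀ j ∈ J, ∃ a, (∀ᶠ u in 𝓝[<] t j, S.indicator (fun _ => (1 : ℝ)) u = a) ∧
      ∀ᶠ u in 𝓝[>] t j, S.indicator (fun _ => (1 : ℝ)) u = a - s j)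
    (htop : ∀ᶠ u in atTop, u ∉ S) {G : ℝ → ℝ} (hG : ContDiff ℝ 1 G) (hGc : HasCompactSupport G) :
    ∫ u, S.indicator (deriv G) u = ∑ j ∈ J, s j * G (t j) := by
  classical
  set χ : ℝ → ℝ := S.indicator (fun _ => (1 : ℝ)) with hχ
  set F : ℝ → ℝ := fun u => ∑ j ∈ J, s j * (Set.Iio (t j)).indicator (fun _ => (1 : ℝ)) u with hF
  have hleft : ∀ p, ∀ᶠ u in 𝓝[<] p, F u = ∑ j ∈ J, s j * if p ≤ t j then 1 else 0 := by
    intro p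
    have : ∀ᶠ u in 𝓝[<] p, ∀ j ∈ J, (u < t j ↔ p ≤ t j) := by
      rw [eventually_all_finset]
      intro j _
      rcases le_or_gt p (t j) with h | h
      · filter_upwards [self_mem_nhdsWithin] with u hu
        exact ⟨fun _ => h, fun _ => lt_of_lt_of_le hu h⟩
      · filter_upwards [nhdsWithin_le_nhds (Ioi_mem_nhds h)] with u hu
        exact ⟨fun h' => absurd h' (not_lt.2 hu.le), fun h' => absurd h (not_lt.2 h')⟩
    filter_upwards [this] with u hu
    refine Finset.sum_congr rfl fun j hj => ?_
    simp [Set.indicator_apply, hu j hj]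
  have hright : ∀ p, ∀ᶠ u in 𝓝[>] p, F u = ∑ j ∈ J, s j * if p < t j then 1 else 0 := by
    intro p
    have : ∀ᶠ u in 𝓝[>] p, ∀ j ∈ J, (u < t j ↔ p < t j) := by
      rw [eventually_all_finset]
      intro j _
      rcases lt_or_ge p (t j) with h | h
      · filter_upwards [nhdsWithin_le_nhds (Iio_mem_nhds h)] with u hu
        exact ⟨fun _ => h, fun _ => hu⟩
      · filter_upwards [self_mem_nhdsWithin] with u hu
        exact ⟨fun h' => absurd (lt_of_le_of_lt h hu) (not_lt.2 h'.le),
          fun h' => absurd h' (not_lt.2 h)⟩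
    filter_upwards [this] with u hu
    refine Finset.sum_congr rfl fun j hj => ?_
    simp [Set.indicator_apply, hu j hj]
  have hnf : ∀ p, (∀ j ∈ J, t j ≠ p) → ∃ c, ∀ᶠ u in 𝓝 p, χ u - F u = c := by
    intro p hp
    have h1 : ∃ a, ∀ᶠ u in 𝓝 p, χ u = a := by
      have hpf : p ∉ frontier S := fun h => by
        obtain ⟨j, hj, hjp⟩ := hfr p h
        exact hp j hj hjp
      rw [← Set.mem_compl_iff, compl_frontier_eq_union_interior] at hpf
      rcases hpf with h | h
      · exact ⟨1, by filter_upwards [mem_interior_iff_mem_nhds.1 h] with u hu; simp [hχ, hu]⟩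
      · exact ⟨0, by filter_upwards [mem_interior_iff_mem_nhds.1 h] with u hu
                     exact Set.indicator_of_notMem hu _⟩
    have h2 : ∀ᶠ u in 𝓝 p, F u = F p := by
      have : ∀ᶠ u in 𝓝 p, ∀ j ∈ J, (u < t j ↔ p < t j) := by
        rw [eventually_all_finset]
        intro j hj
        rcases lt_or_gt_of_ne (hp j hj) with h | h
        · filter_upwards [Ioi_mem_nhds h] with u hu
          exact ⟨fun h' => absurd h' (not_lt.2 hu.le), fun h' => absurd h' (not_lt.2 h.le)⟩
        · filter_upwards [Iio_mem_nhds h] with u hu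
          exact ⟨fun _ => h, fun _ => hu⟩
      filter_upwards [this] with u hu
      refine Finset.sum_congr rfl fun j hj => ?_
      simp [Set.indicator_apply, hu j hj]
    obtain ⟨a, ha⟩ := h1
    exact ⟨a - F p, by filter_upwards [ha, h2] with u h1 h2; rw [h1, h2]⟩
  have hq : ∀ p, ∃ c, ∀ᶠ u in 𝓝[≠] p, χ u - F u = c := by
    intro p
    by_cases hp : ∀ j ∈ J, t j ≠ p
    · obtain ⟨c, hc⟩ := hnf p hp
      exact ⟨c, nhdsWithin_le_nhds hc⟩
    · push Not at hp
      obtain ⟨j, hj, rfl⟩ := hp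
      obtain ⟨a, hal, har⟩ := hjump j hj
      -- the two one-sided sums differ by the jump `s j`, as no other `t k` equals `t j`
      have hdiff : ∑ k ∈ J, s k * (if t j ≤ t k then 1 else 0)
          = (∑ k ∈ J, s k * if t j < t k then 1 else 0) + s j := by
        rw [← sub_eq_iff_eq_add', ← Finset.sum_sub_distrib, Finset.sum_eq_single_of_mem j hj]
        · simp
        · intro k hk hkj
          have : t j ≠ t k := fun h => hkj (hinj hk hj h.symm)
          have h' : t j ≤ t k ↔ t j < t k := ⟨fun h => lt_of_le_of_ne h this, le_of_lt⟩
          simp [h']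
      refine ⟨a - ∑ k ∈ J, s k * (if t j ≤ t k then 1 else 0), ?_⟩
      rw [← Set.Iio_union_Ioi, nhdsWithin_union, eventually_sup]
      constructor
      · filter_upwards [hal, hleft (t j)] with u h1 h2
        rw [h1, h2]
      · filter_upwards [har, hright (t j)] with u h1 h2
        rw [h1, h2, hdiff]; ring
  have hqtop : ∀ᶠ u in atTop, χ u - F u = 0 := by
    have : ∀ᶠ u in atTop, ∀ j ∈ J, t j ≤ u := by
      rw [eventually_all_finset]
      exact fun j _ => eventually_ge_atTop _
    filter_upwards [htop, this] with u h1 h2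
    have hF0 : F u = 0 := Finset.sum_eq_zero fun j hj => by simp [h2 j hj]
    rw [hF0]; simp [hχ, h1]
  have hzero := eq_zero_of_eventually_const hq hqtop
  have hae : ∀ᵐ u, χ u = F u := by
    have hfin : volume (t '' (J : Set ι)) = 0 := (J.finite_toSet.image t).measure_zero _
    filter_upwards [measure_eq_zero_iff_ae_notMem.1 hfin] with u hu
    obtain ⟨c, hc⟩ := hnf u fun j hj hju => hu ⟨j, hj, hju⟩
    obtain ⟨w, hw1, hw2⟩ := ((hzero u).and (nhdsWithin_le_nhds hc)).exists
    have := hc.self_of_nhds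
    rw [← hw2, hw1] at this
    linarith
  have hG'c : HasCompactSupport (deriv G) := hGc.deriv
  have hG' : Continuous (deriv G) := hG.continuous_deriv le_rfl
  have hint : Integrable (deriv G) := hG'.integrable_of_hasCompactSupport hG'c
  calc ∫ u, S.indicator (deriv G) u
      = ∫ u, ∑ j ∈ J, s j * (Set.Iio (t j)).indicator (deriv G) u := by
        refine integral_congr_ae ?_
        filter_upwards [hae] with u hu
        have h1 : S.indicator (deriv G) u = χ u * deriv G u := by
          simp [hχ, Set.indicator_apply]
        rw [h1, hu, hF, Finset.sum_mul]
        refine Finset.sum_congr rfl fun j _ => ?_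
        simp [Set.indicator_apply]
    _ = ∑ j ∈ J, s j * G (t j) := by
        rw [integral_finsetSum]
        · refine Finset.sum_congr rfl fun j _ => ?_
          rw [integral_const_mul, integral_indicator measurableSet_Iio,
            ← integral_Iic_eq_integral_Iio, hGc.integral_Iic_deriv_eq hG]
        · exact fun j _ => (hint.indicator measurableSet_Iio).const_mul _

/-! ### Hyperplanes and oblique projections -/

variable {d : ℕ}

/-- The hyperplane `{x | ⟪n, x⟫ = c}`. -/
def hyperplane (n : Eu d) (c : ℝ) : Set (Eu d) := {x | inner ℝ n x = c}

/-- The projection along `v` onto the hyperplane `{x | ⟪n, x⟫ = c}`, meaningful when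
`⟪n, v⟫ ≠ 0`. -/
def obliqueProj (n : Eu d) (c : ℝ) (v x : Eu d) : Eu d :=
  x + ((c - inner ℝ n x) / inner ℝ n v) • v

theorem continuous_obliqueProj (n : Eu d) (c : ℝ) (v : Eu d) :
    Continuous (obliqueProj n c v) := by
  unfold obliqueProj
  fun_prop

theorem volume_hyperplane {n : Eu d} (hn : n ≠ 0) (c : ℝ) : volume (hyperplane n c) = 0 := by
  let s : AffineSubspace ℝ (Eu d) := AffineSubspace.mk' ((c / ‖n‖ ^ 2) • n) (ℝ ∙ n)ᗮ
  have hs : s ≠ ⊤ := by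
    intro h
    have : s.direction = ⊤ := by rw [h]; exact AffineSubspace.direction_top ℝ _ _
    rw [AffineSubspace.direction_mk', Submodule.orthogonal_eq_top_iff,
      Submodule.span_singleton_eq_bot] at this
    exact hn this
  refine measure_mono_null (fun x hx => ?_) (Measure.addHaar_affineSubspace volume s hs)
  change x ∈ s
  rw [AffineSubspace.mem_mk', Submodule.mem_orthogonal_singleton_iff_inner_right, vsub_eq_sub,
    inner_sub_right, inner_smul_right, real_inner_self_eq_norm_sq, show inner ℝ n x = c from hx]
  have : ‖n‖ ≠ 0 := norm_ne_zero_iff.2 hn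
  field_simp
  ring

theorem finrank_orthogonal_span {n : Eu d} (hn : n ≠ 0) :
    Module.finrank ℝ (ℝ ∙ n)ᗮ = d - 1 := by
  have h := (ℝ ∙ n).finrank_add_finrank_orthogonal
  rw [finrank_span_singleton hn, finrank_euclideanSpace_fin] at h
  omega

/-- Isometric parametrization of a hyperplane by the orthogonal of its normal. -/
theorem map_volume_hyperplane {n : Eu d} (hn : ‖n‖ = 1) (c : ℝ) :
    Measure.map (fun p : (ℝ ∙ n)ᗮ => c • n + (p : Eu d)) volume
      = (Measure.euclideanHausdorffMeasure (X := Eu d) (d - 1)).restrict (hyperplane n c) := by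
  have hn0 : n ≠ 0 := norm_ne_zero_iff.1 (by rw [hn]; exact one_ne_zero)
  have hiso : Isometry (fun p : (ℝ ∙ n)ᗮ => c • n + (p : Eu d)) :=
    (IsometryEquiv.addLeft (c • n)).isometry.comp isometry_subtype_coe
  rw [← InnerProductSpace.euclideanHausdorffMeasure_eq_volume, finrank_orthogonal_span hn0,
    hiso.map_euclideanHausdorffMeasure]
  congr 1
  ext x
  constructor
  · rintro ⟨p, rfl⟩
    have := Submodule.mem_orthogonal_singleton_iff_inner_right.1 p.2
    simp [hyperplane, inner_add_right, inner_smul_right, this, hn]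
  · intro hx
    refine ⟨⟨x - c • n, ?_⟩, by simp⟩
    rw [Submodule.mem_orthogonal_singleton_iff_inner_right, inner_sub_right, inner_smul_right,
      real_inner_self_eq_norm_sq, hn, show inner ℝ n x = c from hx]
    ring

/-- Lebesgue measure in the coordinates `(s, p)`, where `p` parametrizes the hyperplane and `s` is
the displacement along a vector `w` with `⟪n, w⟫ = 1`. -/
theorem measurePreserving_hyperplane_add_smul {n w : Eu d} (hn : ‖n‖ = 1) (hw : inner ℝ n w = 1)
    (c : ℝ) : MeasurePreserving
      (fun q : ℝ × (ℝ ∙ n)ᗮ => c • n + (q.2 : Eu d) + q.1 • w) := by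
  -- a shear along the hyperplane turns the orthogonal displacement `n` into `w`
  have hu : w - n ∈ (ℝ ∙ n)ᗮ := by
    rw [Submodule.mem_orthogonal_singleton_iff_inner_right, inner_sub_right,
      real_inner_self_eq_norm_sq, hn, hw]
    norm_num
  have h1 : MeasurePreserving (fun q : ℝ × (ℝ ∙ n)ᗮ => (q.1, q.2 + q.1 • (⟨w - n, hu⟩ : (ℝ ∙ n)ᗮ)))
      := by
    refine (MeasurePreserving.id volume).skew_product (μc := volume) (μd := volume)
      (g := fun s p => p + s • (⟨w - n, hu⟩ : (ℝ ∙ n)ᗮ)) ?_ ?_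
    · exact (by fun_prop : Continuous fun q : ℝ × (ℝ ∙ n)ᗮ =>
        q.2 + q.1 • (⟨w - n, hu⟩ : (ℝ ∙ n)ᗮ)).measurable
    · exact Eventually.of_forall fun s => map_add_right_eq_self volume _
  have h2 : MeasurePreserving (fun q : ℝ × (ℝ ∙ n)ᗮ =>
      (LinearIsometryEquiv.toSpanUnitSingleton (𝕜 := ℝ) n hn q.1, q.2)) :=
    (LinearIsometryEquiv.measurePreserving _).prod (MeasurePreserving.id volume)
  have h3 := ((ℝ ∙ n).measurePreserving_measurableEquivProd (c • n)).symm
  rw [InnerProductSpace.euclideanHausdorffMeasure_eq_volume] at h3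
  have h := h3.comp (h2.comp h1)
  convert h using 1
  ext q : 1
  simp [Submodule.measurableEquivProd_symm_apply, LinearIsometryEquiv.toSpanUnitSingleton]
  module

/-- Lebesgue measure in the coordinates `(s, p)`, where `p` is the projection along the unit
vector `v` onto the hyperplane and `s / ⟪n, v⟫` is the coordinate along `v`. -/
theorem measurePreserving_obliqueCoord {n v : Eu d} (hn : ‖n‖ = 1)
    (hnv : inner ℝ n v ≠ 0) (c : ℝ) : MeasurePreserving
      (fun q : ℝ × (ℝ ∙ n)ᗮ => c • n + (q.2 : Eu d)
        + (q.1 / inner ℝ n v - inner ℝ (c • n + (q.2 : Eu d)) v) • v) := by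
  have h1 : MeasurePreserving (fun q : (ℝ ∙ n)ᗮ × ℝ =>
      (q.1, q.2 + -(inner ℝ n v * inner ℝ (c • n + (q.1 : Eu d)) v))) := by
    refine (MeasurePreserving.id volume).skew_product (μc := volume) (μd := volume)
      (g := fun (p : (ℝ ∙ n)ᗮ) s => s + -(inner ℝ n v * inner ℝ (c • n + (p : Eu d)) v)) ?_ ?_
    · exact (by fun_prop : Continuous fun q : (ℝ ∙ n)ᗮ × ℝ =>
        q.2 + -(inner ℝ n v * inner ℝ (c • n + (q.1 : Eu d)) v)).measurable
    · exact Eventually.of_forall fun s => map_add_right_eq_self volume _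
  have hw : inner ℝ n ((inner ℝ n v)⁻¹ • v) = 1 := by
    rw [inner_smul_right, inv_mul_cancel₀ hnv]
  have h : MeasurePreserving _ volume volume := (measurePreserving_hyperplane_add_smul hn hw c).comp
    ((Measure.measurePreserving_swap).comp (h1.comp Measure.measurePreserving_swap))
  refine (congrArg (MeasurePreserving · volume volume) (funext fun q => ?_)).mp h
  simp only [Function.comp, Prod.swap, smul_smul]
  congr 2
  field_simp
  ring

theorem inner_obliqueCoord {n v : Eu d} (hv : ‖v‖ = 1) (c : ℝ) (q : ℝ × (ℝ ∙ n)ᗮ) :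
    inner ℝ (c • n + (q.2 : Eu d)
        + (q.1 / inner ℝ n v - inner ℝ (c • n + (q.2 : Eu d)) v) • v) v = q.1 / inner ℝ n v := by
  rw [inner_add_left, inner_smul_left, real_inner_self_eq_norm_sq, hv]
  simp

theorem obliqueProj_add_smul {n v : Eu d} (hnv : inner ℝ n v ≠ 0) (c : ℝ) {y : Eu d}
    (hy : y ∈ hyperplane n c) (a : ℝ) : obliqueProj n c v (y + a • v) = y := by
  have hy : inner ℝ n y = c := hy
  rw [obliqueProj, inner_add_right, inner_smul_right, hy, add_assoc, ← add_smul]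
  have : a + (c - (c + a * inner ℝ n v)) / inner ℝ n v = 0 := by field_simp; ring
  rw [this]; simp

theorem smul_add_mem_hyperplane {n : Eu d} (hn : ‖n‖ = 1) (c : ℝ) (p : (ℝ ∙ n)ᗮ) :
    c • n + (p : Eu d) ∈ hyperplane n c := by
  have := Submodule.mem_orthogonal_singleton_iff_inner_right.1 p.2
  simp [hyperplane, inner_add_right, inner_smul_right, this, hn]

/-- A negligible part of a hyperplane is met by almost no line of a given transversal direction. -/
theorem quasiMeasurePreserving_obliqueProj {n v : Eu d} (hn : ‖n‖ = 1)
    (hnv : inner ℝ n v ≠ 0) (c : ℝ) :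
    Measure.QuasiMeasurePreserving (obliqueProj n c v) volume
      ((Measure.euclideanHausdorffMeasure (X := Eu d) (d - 1)).restrict (hyperplane n c)) := by
  refine ⟨(continuous_obliqueProj n c v).measurable, ?_⟩
  have hΞ := measurePreserving_obliqueCoord hn hnv c
  have hι : Measurable (fun p : (ℝ ∙ n)ᗮ => c • n + (p : Eu d)) := by fun_prop
  rw [← map_volume_hyperplane hn c, ← hΞ.map_eq,
    Measure.map_map (continuous_obliqueProj n c v).measurable hΞ.measurable]
  have : obliqueProj n c v ∘ (fun q : ℝ × (ℝ ∙ n)ᗮ => c • n + (q.2 : Eu d)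
        + (q.1 / inner ℝ n v - inner ℝ (c • n + (q.2 : Eu d)) v) • v)
      = (fun p : (ℝ ∙ n)ᗮ => c • n + (p : Eu d)) ∘ Prod.snd := by
    ext q : 1
    exact obliqueProj_add_smul hnv c (smul_add_mem_hyperplane hn c q.2) _
  rw [this, ← Measure.map_map hι measurable_snd]
  exact Measure.quasiMeasurePreserving_snd.absolutelyContinuous.map hι

theorem ae_obliqueProj {n v : Eu d} (hn : ‖n‖ = 1)
    (hnv : inner ℝ n v ≠ 0) (c : ℝ) {σ : Set (Eu d)} (hσ : MeasurableSet σ) {p : Eu d → Prop}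
    (hp : ∀ᵐ y ∂(Measure.euclideanHausdorffMeasure (X := Eu d) (d - 1)).restrict σ, p y) :
    ∀ᵐ x, obliqueProj n c v x ∈ σ → p (obliqueProj n c v x) := by
  rw [ae_restrict_iff' hσ] at hp
  exact (quasiMeasurePreserving_obliqueProj hn hnv c).ae (ae_restrict_of_ae hp)

/-- The indicator function of `[0, 1)`. Used as a weight in the variable `⟪x, v⟫`, it turns
the integral over the whole space of a function of the line `x + ℝ v` into the integral of this
function over the lines parallel to `v`. -/
def unitWeight : ℝ → ℝ := (Set.Ico 0 1).indicator fun _ => 1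

theorem measurable_unitWeight : Measurable unitWeight :=
  measurable_const.indicator measurableSet_Ico

theorem integrable_unitWeight : Integrable unitWeight :=
  (integrable_indicator_iff measurableSet_Ico).2 (by simp)

theorem integral_unitWeight : ∫ s, unitWeight s = 1 := by
  simp [unitWeight, integral_indicator measurableSet_Ico]

/-- The oblique projection contracts areas by the factor `|⟪n, v⟫|`. -/
theorem integral_unitWeight_mul_obliqueProj {n v : Eu d} (hn : ‖n‖ = 1) (hv : ‖v‖ = 1)
    (hnv : inner ℝ n v ≠ 0) (c : ℝ) {f : Eu d → ℝ} (hf : StronglyMeasurable f)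
    (hfi : IntegrableOn f (hyperplane n c) (Measure.euclideanHausdorffMeasure (d - 1))) :
    Integrable (fun x => unitWeight (inner ℝ x v) * f (obliqueProj n c v x)) ∧
    ∫ x, unitWeight (inner ℝ x v) * f (obliqueProj n c v x)
      = |inner ℝ n v| * ∫ y in hyperplane n c, f y ∂Measure.euclideanHausdorffMeasure (d - 1) := by
  have hΞ := measurePreserving_obliqueCoord hn hnv c
  have hι : Measurable (fun p : (ℝ ∙ n)ᗮ => c • n + (p : Eu d)) := by fun_prop
  have hmeas : AEStronglyMeasurable
      (fun x => unitWeight (inner ℝ x v) * f (obliqueProj n c v x)) volume :=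
    ((measurable_unitWeight.comp (by fun_prop)).mul
      (hf.measurable.comp (continuous_obliqueProj n c v).measurable)).aestronglyMeasurable
  have hcomp : (fun x => unitWeight (inner ℝ x v) * f (obliqueProj n c v x)) ∘
      (fun q : ℝ × (ℝ ∙ n)ᗮ => c • n + (q.2 : Eu d)
        + (q.1 / inner ℝ n v - inner ℝ (c • n + (q.2 : Eu d)) v) • v)
      = fun q => unitWeight (q.1 / inner ℝ n v) * f (c • n + (q.2 : Eu d)) := by
    ext q
    simp only [Function.comp]
    rw [inner_obliqueCoord hv, obliqueProj_add_smul hnv c (smul_add_mem_hyperplane hn c q.2)]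
  rw [IntegrableOn, ← map_volume_hyperplane hn c,
    integrable_map_measure hf.aestronglyMeasurable hι.aemeasurable] at hfi
  constructor
  · rw [← hΞ.integrable_comp hmeas, hcomp]
    exact (integrable_unitWeight.comp_div hnv).mul_prod hfi
  · rw [← map_volume_hyperplane hn c, integral_map hι.aemeasurable hf.aestronglyMeasurable]
    have h := integral_map (μ := volume) hΞ.measurable.aemeasurable (by rw [hΞ.map_eq]; exact hmeas)
    rw [hΞ.map_eq] at h
    rw [h]
    have h' := fun q => congrFun hcomp q
    simp only [Function.comp] at h'
    simp only [h']
    rw [Measure.volume_eq_prod, integral_prod_mul (fun s => unitWeight (s / inner ℝ n v))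
      (fun p : (ℝ ∙ n)ᗮ => f (c • n + (p : Eu d))), Measure.integral_comp_div,
      integral_unitWeight]
    simp

/-! ### The divergence theorem on a cell -/

/-- The fundamental theorem of calculus on the trace of the cell `K` on the line `x + ℝ v`, for a
line that avoids the faces parallel to `v` and meets the other ones at points where `K` lies on
exactly one side and which belong to no other face. -/
theorem integral_line_indicator_fderiv {K : Set (Eu d)} (hKb : Bornology.IsBounded K)
    {F : Finset (Set (Eu d))} {N : Set (Eu d) → Eu d} {c : Set (Eu d) → ℝ}
    (hfr : frontier K = ⋃ σ ∈ F, σ) (hc : ∀ σ ∈ F, σ ⊆ hyperplane (N σ) (c σ))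
    {g : Eu d → ℝ} (hg : ContDiff ℝ 1 g) (hgc : HasCompactSupport g) {v : Eu d} (hv : ‖v‖ = 1)
    {x : Eu d} (hpar : ∀ σ ∈ F, inner ℝ (N σ) v = 0 → x ∉ hyperplane (N σ) (c σ))
    (htrans : ∀ σ ∈ F, inner ℝ (N σ) v ≠ 0 → obliqueProj (N σ) (c σ) v x ∈ σ →
      (∃ ε > 0,
        (∀ y ∈ Metric.ball (obliqueProj (N σ) (c σ) v x) ε,
          inner ℝ (N σ) (y - obliqueProj (N σ) (c σ) v x) < 0 → y ∈ K) ∧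
        (∀ y ∈ Metric.ball (obliqueProj (N σ) (c σ) v x) ε,
          0 < inner ℝ (N σ) (y - obliqueProj (N σ) (c σ) v x) → y ∉ K)) ∧
      ∀ τ ∈ F, τ ≠ σ → obliqueProj (N σ) (c σ) v x ∉ τ) :
    ∫ t : ℝ, K.indicator (fun y => fderiv ℝ g y v) (x + t • v)
      = ∑ σ ∈ F with inner ℝ (N σ) v ≠ 0, (SignType.sign (inner ℝ (N σ) v) : ℝ) *
          σ.indicator g (obliqueProj (N σ) (c σ) v x) := by
  classical
  set ℓ : ℝ → Eu d := fun t => x + t • v with hℓ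
  have hℓc : Continuous ℓ := by fun_prop
  have hℓi : Isometry ℓ := Isometry.of_dist_eq fun a b => by
    rw [hℓ, dist_add_left, dist_eq_norm, ← sub_smul, norm_smul, hv, mul_one]; rfl
  set T : Set (Eu d) → ℝ := fun σ => (c σ - inner ℝ (N σ) x) / inner ℝ (N σ) v with hT
  have hTP : ∀ σ, ℓ (T σ) = obliqueProj (N σ) (c σ) v x := fun σ => rfl
  have hderiv : ∀ t, HasDerivAt (fun t => g (ℓ t)) (fderiv ℝ g (ℓ t) v) t := by
    intro t
    have h1 : HasDerivAt ℓ v t := by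
      have := ((hasDerivAt_id t).smul_const v).const_add x
      rwa [one_smul] at this
    exact ((hg.differentiable one_ne_zero _).hasFDerivAt).comp_hasDerivAt t h1
  have key := integral_indicator_deriv_eq_sum (S := ℓ ⁻¹' K) (G := fun t => g (ℓ t))
    (F.filter fun σ => inner ℝ (N σ) v ≠ 0 ∧ obliqueProj (N σ) (c σ) v x ∈ σ) T
    (fun σ => (SignType.sign (inner ℝ (N σ) v) : ℝ)) ?_ ?_ ?_ ?_ (hg.comp (by fun_prop))
    (hgc.comp_isClosedEmbedding hℓi.isClosedEmbedding)
  · rw [Finset.filter_and, ← Finset.filter_and, ← Finset.filter_filter, Finset.sum_filter] at key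
    convert key using 1
    · refine integral_congr_ae (Eventually.of_forall fun t => ?_)
      by_cases ht : ℓ t ∈ K
      · have ht' : t ∈ ℓ ⁻¹' K := ht
        simp only [Set.indicator_of_mem ht', (hderiv t).deriv]
        exact Set.indicator_of_mem ht _
      · have ht' : t ∉ ℓ ⁻¹' K := ht
        simp only [Set.indicator_of_notMem ht']
        exact Set.indicator_of_notMem ht _
    · refine Finset.sum_congr rfl fun σ _ => ?_
      rw [Set.indicator_apply, hTP]
      split_ifs <;> simp
  · intro σ hσ τ hτ h
    rw [Finset.mem_coe, Finset.mem_filter] at hσ hτ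
    by_contra hne
    refine (htrans σ hσ.1 hσ.2.1 hσ.2.2).2 τ hτ.1 (Ne.symm hne) ?_
    rw [← hTP, h, hTP]
    exact hτ.2.2
  · intro u hu
    have h1 : ℓ u ∈ frontier K := hℓc.frontier_preimage_subset K hu
    rw [hfr, Set.mem_iUnion₂] at h1
    obtain ⟨σ, hσ, hmem⟩ := h1
    have hpl : inner ℝ (N σ) (x + u • v) = c σ := hc σ hσ hmem
    rw [inner_add_right, inner_smul_right] at hpl
    have hne : inner ℝ (N σ) v ≠ 0 := by
      intro h0
      refine hpar σ hσ h0 ?_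
      rw [h0] at hpl
      simpa [hyperplane] using hpl
    have hTu : T σ = u := by
      rw [hT]; simp only; rw [div_eq_iff hne]; linarith
    refine ⟨σ, Finset.mem_filter.2 ⟨hσ, hne, ?_⟩, hTu⟩
    rw [← hTP, hTu]
    exact hmem
  · intro σ hσ
    rw [Finset.mem_filter] at hσ
    obtain ⟨hσ, hne, hmem⟩ := hσ
    obtain ⟨ε, hε, hin, hout⟩ := (htrans σ hσ hne hmem).1
    rw [← hTP] at hin hout
    have hball : ∀ᶠ u in 𝓝 (T σ), ℓ u ∈ Metric.ball (ℓ (T σ)) ε :=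
      hℓc.continuousAt.eventually (Metric.ball_mem_nhds _ hε)
    have hinner : ∀ u, inner ℝ (N σ) (ℓ u - ℓ (T σ)) = (u - T σ) * inner ℝ (N σ) v := by
      intro u
      rw [hℓ]
      simp only [add_sub_add_left_eq_sub]
      rw [← sub_smul, inner_smul_right]
    rcases lt_or_gt_of_ne hne with hneg | hpos
    · refine ⟨0, ?_, ?_⟩
      · filter_upwards [self_mem_nhdsWithin, nhdsWithin_le_nhds hball] with u hu hub
        refine Set.indicator_of_notMem (s := ℓ ⁻¹' K) (hout _ hub ?_) _
        rw [hinner]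
        exact mul_pos_of_neg_of_neg (sub_neg.2 hu) hneg
      · filter_upwards [self_mem_nhdsWithin, nhdsWithin_le_nhds hball] with u hu hub
        rw [Set.indicator_of_mem (s := ℓ ⁻¹' K) (hin _ hub ?_)]
        · simp [sign_neg hneg]
        · rw [hinner]
          exact mul_neg_of_pos_of_neg (sub_pos.2 hu) hneg
    · refine ⟨1, ?_, ?_⟩
      · filter_upwards [self_mem_nhdsWithin, nhdsWithin_le_nhds hball] with u hu hub
        rw [Set.indicator_of_mem (s := ℓ ⁻¹' K) (hin _ hub ?_)]
        rw [hinner]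
        exact mul_neg_of_neg_of_pos (sub_neg.2 hu) hpos
      · filter_upwards [self_mem_nhdsWithin, nhdsWithin_le_nhds hball] with u hu hub
        rw [Set.indicator_of_notMem (s := ℓ ⁻¹' K) (hout _ hub ?_)]
        · simp [sign_pos hpos]
        · rw [hinner]
          exact mul_pos (sub_pos.2 hu) hpos
  · obtain ⟨R, hR⟩ := hKb.exists_norm_le
    filter_upwards [eventually_gt_atTop (R + ‖x‖), eventually_ge_atTop 0] with u hu hu0 huK
    have h1 := hR _ huK
    have h2 : ‖u • v‖ ≤ ‖x + u • v‖ + ‖x‖ := by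
      calc ‖u • v‖ = ‖(x + u • v) - x‖ := by rw [add_sub_cancel_left]
        _ ≤ _ := norm_sub_le _ _
    rw [norm_smul, hv, mul_one, Real.norm_of_nonneg hu0] at h2
    have h1' : ‖x + u • v‖ ≤ R := h1
    linarith

/-- A substitute for Fubini's theorem over the quotient by `ℝ v`: a pair (origin of the line,
parameter) is exchanged for a pair (point reached, height of the origin along `v`). -/
theorem measurePreserving_line {v : Eu d} (hv : ‖v‖ = 1) :
    MeasurePreserving (fun q : Eu d × ℝ => (q.1 + q.2 • v, inner ℝ q.1 v)) := by
  have h1 : MeasurePreserving (fun q : ℝ × Eu d => (q.1, q.2 + q.1 • v)) volume volume := by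
    refine (MeasurePreserving.id volume).skew_product (μc := volume) (μd := volume)
      (g := fun (t : ℝ) (x : Eu d) => x + t • v) ?_ ?_
    · exact (by fun_prop : Continuous fun q : ℝ × Eu d => q.2 + q.1 • v).measurable
    · exact Eventually.of_forall fun s => map_add_right_eq_self volume _
  have h2 : MeasurePreserving (fun q : Eu d × ℝ => (q.1, inner ℝ q.1 v - q.2)) volume volume := by
    refine (MeasurePreserving.id volume).skew_product (μc := volume) (μd := volume)
      (g := fun (y : Eu d) (t : ℝ) => inner ℝ y v - t) ?_ ?_
    · exact (by fun_prop : Continuous fun q : Eu d × ℝ => inner ℝ q.1 v - q.2).measurable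
    · exact Eventually.of_forall fun y =>
        (Measure.measurePreserving_sub_left volume (inner ℝ y v)).map_eq
  have h : MeasurePreserving _ volume volume :=
    h2.comp (Measure.measurePreserving_swap.comp (h1.comp Measure.measurePreserving_swap))
  refine (congrArg (MeasurePreserving · volume volume) (funext fun q => ?_)).mp h
  simp [inner_add_left, inner_smul_left, hv]

theorem integral_unitWeight_mul_line {v : Eu d} (hv : ‖v‖ = 1) {h : Eu d → ℝ}
    (hh : Integrable h) :
    ∫ x, unitWeight (inner ℝ x v) * ∫ t : ℝ, h (x + t • v) = ∫ x, h x := by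
  have hΛ := measurePreserving_line hv
  have hprod : Integrable (fun q : Eu d × ℝ => h q.1 * unitWeight q.2) volume :=
    hh.mul_prod integrable_unitWeight
  have hint := (hΛ.integrable_comp hprod.aestronglyMeasurable).2 hprod
  have h1 := integral_map (μ := volume) hΛ.measurable.aemeasurable
    (by rw [hΛ.map_eq]; exact hprod.aestronglyMeasurable)
  rw [hΛ.map_eq] at h1
  calc ∫ x, unitWeight (inner ℝ x v) * ∫ t : ℝ, h (x + t • v)
      = ∫ x, ∫ t : ℝ, h (x + t • v) * unitWeight (inner ℝ x v) := by
        refine integral_congr_ae (Eventually.of_forall fun x => ?_)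
        simp only
        rw [integral_mul_const, mul_comm]
    _ = ∫ q : Eu d × ℝ, h (q.1 + q.2 • v) * unitWeight (inner ℝ q.1 v) :=
        (integral_prod _ hint).symm
    _ = ∫ q : Eu d × ℝ, h q.1 * unitWeight q.2 := h1.symm
    _ = ∫ x, h x := by
        rw [Measure.volume_eq_prod, integral_prod_mul, integral_unitWeight, mul_one]

/-- The divergence theorem on a polyhedral cell `K`, for the field `g • v`: the fundamental theorem
of calculus on almost every line parallel to `v`, integrated over the lines. A face `σ` contributes
with the sign of `⟪N σ, v⟫`, and its projection along `v` has area `|⟪N σ, v⟫| |σ|`. -/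
theorem integral_fderiv_eq_sum_faces {K : Set (Eu d)} (hKm : MeasurableSet K)
    (hKb : Bornology.IsBounded K) {F : Finset (Set (Eu d))} {N : Set (Eu d) → Eu d}
    (hFm : ∀ σ ∈ F, MeasurableSet σ) (hFpos : ∀ σ ∈ F, 0 < faceMeasure σ)
    (hfr : frontier K = ⋃ σ ∈ F, σ)
    (hdisj : ∀ σ ∈ F, ∀ τ ∈ F, σ ≠ τ → faceMeasure (σ ∩ τ) = 0)
    (hN : ∀ σ ∈ F, IsOutwardUnitNormal K σ (N σ))
    {g : Eu d → ℝ} (hg : ContDiff ℝ 1 g) (hgc : HasCompactSupport g) {v : Eu d} (hv : ‖v‖ = 1) :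
    ∫ x in K, fderiv ℝ g x v
      = ∑ σ ∈ F, inner ℝ (N σ) v * ∫ y in σ, g y ∂Measure.euclideanHausdorffMeasure (d - 1) := by
  classical
  have hflat : ∀ σ, ∃ c, σ ∈ F → σ ⊆ hyperplane (N σ) c := by
    intro σ
    by_cases hσ : σ ∈ F
    · obtain ⟨c, hc⟩ := (hN σ hσ).flat
      exact ⟨c, fun _ y hy => hc y hy⟩
    · exact ⟨0, fun h => absurd h hσ⟩
  choose c hc using hflat
  have hn1 : ∀ σ ∈ F, ‖N σ‖ = 1 := fun σ hσ => (hN σ hσ).norm_eq_one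
  have hfin : ∀ σ ∈ F, Measure.euclideanHausdorffMeasure (X := Eu d) (d - 1) σ ≠ ⊤ := by
    intro σ hσ h
    have := hFpos σ hσ
    simp [faceMeasure, Measure.real, h] at this
  have hcont : Continuous fun x => fderiv ℝ g x v :=
    (hg.continuous_fderiv one_ne_zero).clm_apply continuous_const
  have hcs : HasCompactSupport fun x => fderiv ℝ g x v := hgc.fderiv_apply ℝ v
  have hint : Integrable (K.indicator fun x => fderiv ℝ g x v) :=
    (hcont.integrable_of_hasCompactSupport hcs).indicator hKm
  obtain ⟨B, hB⟩ := hgc.exists_bound_of_continuous hg.continuous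
  have hgσ : ∀ σ ∈ F, IntegrableOn g σ (Measure.euclideanHausdorffMeasure (d - 1)) := by
    intro σ hσ
    exact Measure.integrableOn_of_bounded (hfin σ hσ) hg.continuous.aestronglyMeasurable
      (Eventually.of_forall hB)
  -- the lines parallel to `v` that avoid the negligible parts of the faces
  have hgood : ∀ᵐ x : Eu d, ∀ σ ∈ F,
      (inner ℝ (N σ) v = 0 → x ∉ hyperplane (N σ) (c σ)) ∧
      (inner ℝ (N σ) v ≠ 0 → obliqueProj (N σ) (c σ) v x ∈ σ →
      (∃ ε > 0,
        (∀ y ∈ Metric.ball (obliqueProj (N σ) (c σ) v x) ε,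
          inner ℝ (N σ) (y - obliqueProj (N σ) (c σ) v x) < 0 → y ∈ K) ∧
        (∀ y ∈ Metric.ball (obliqueProj (N σ) (c σ) v x) ε,
          0 < inner ℝ (N σ) (y - obliqueProj (N σ) (c σ) v x) → y ∉ K)) ∧
      ∀ τ ∈ F, τ ≠ σ → obliqueProj (N σ) (c σ) v x ∉ τ) := by
    rw [Finset.eventually_all]
    intro σ hσ
    have hn0 : N σ ≠ 0 := norm_ne_zero_iff.1 (by rw [hn1 σ hσ]; exact one_ne_zero)
    by_cases hσv : inner ℝ (N σ) v = 0
    · filter_upwards [measure_eq_zero_iff_ae_notMem.1 (volume_hyperplane hn0 (c σ))] with x hx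
      exact ⟨fun _ => hx, fun h => absurd hσv h⟩
    · have hτ : ∀ᵐ y ∂(Measure.euclideanHausdorffMeasure (X := Eu d) (d - 1)).restrict σ,
          ∀ τ ∈ F, τ ≠ σ → y ∉ τ := by
        rw [Finset.eventually_all]
        intro τ hτ
        by_cases hne : τ = σ
        · exact Eventually.of_forall fun _ h => absurd hne h
        · have h0 := hdisj τ hτ σ hσ hne
          rw [faceMeasure, measureReal_eq_zero_iff
            (measure_ne_top_of_subset Set.inter_subset_left (hfin τ hτ))] at h0
          have h1 : (Measure.euclideanHausdorffMeasure (X := Eu d) (d - 1)).restrict σ τ = 0 := by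
            rw [Measure.restrict_apply (hFm τ hτ), h0]
          filter_upwards [measure_eq_zero_iff_ae_notMem.1 h1] with y hy _
          exact hy
      filter_upwards [ae_obliqueProj (hn1 σ hσ) hσv (c σ) (hFm σ hσ)
        ((hN σ hσ).outward.and hτ)] with x hx
      exact ⟨fun h => absurd h hσv, fun _ => hx⟩
  have hterm : ∀ σ ∈ F, inner ℝ (N σ) v ≠ 0 →
      Integrable (fun x => unitWeight (inner ℝ x v) *
        σ.indicator g (obliqueProj (N σ) (c σ) v x)) ∧
      ∫ x, unitWeight (inner ℝ x v) * σ.indicator g (obliqueProj (N σ) (c σ) v x)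
        = |inner ℝ (N σ) v| * ∫ y in σ, g y ∂Measure.euclideanHausdorffMeasure (d - 1) := by
    intro σ hσ hσv
    have h := integral_unitWeight_mul_obliqueProj (hn1 σ hσ) hv hσv (c σ)
      (f := σ.indicator g) (hg.continuous.stronglyMeasurable.indicator (hFm σ hσ))
      ((integrable_indicator_iff (hFm σ hσ)).2 (hgσ σ hσ)).integrableOn
    rwa [setIntegral_indicator (hFm σ hσ), Set.inter_eq_right.2 (hc σ hσ)] at h
  calc ∫ x in K, fderiv ℝ g x v = ∫ x, K.indicator (fun x => fderiv ℝ g x v) x :=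
        (integral_indicator hKm).symm
    _ = ∫ x, unitWeight (inner ℝ x v) *
          ∫ t : ℝ, K.indicator (fun x => fderiv ℝ g x v) (x + t • v) :=
        (integral_unitWeight_mul_line hv hint).symm
    _ = ∫ x, ∑ σ ∈ F with inner ℝ (N σ) v ≠ 0, (SignType.sign (inner ℝ (N σ) v) : ℝ) *
          (unitWeight (inner ℝ x v) * σ.indicator g (obliqueProj (N σ) (c σ) v x)) := by
        refine integral_congr_ae ?_
        filter_upwards [hgood] with x hx
        rw [integral_line_indicator_fderiv hKb hfr hc hg hgc hv (fun σ hσ => (hx σ hσ).1)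
          (fun σ hσ => (hx σ hσ).2), Finset.mul_sum]
        exact Finset.sum_congr rfl fun σ _ => by ring
    _ = ∑ σ ∈ F with inner ℝ (N σ) v ≠ 0, inner ℝ (N σ) v *
          ∫ y in σ, g y ∂Measure.euclideanHausdorffMeasure (d - 1) := by
        rw [integral_finsetSum]
        · refine Finset.sum_congr rfl fun σ hσ => ?_
          rw [Finset.mem_filter] at hσ
          rw [integral_const_mul, (hterm σ hσ.1 hσ.2).2, ← mul_assoc, sign_mul_abs]
        · intro σ hσ
          rw [Finset.mem_filter] at hσ
          exact (hterm σ hσ.1 hσ.2).1.const_mul _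
    _ = _ := by
        rw [Finset.sum_filter]
        refine Finset.sum_congr rfl fun σ _ => ?_
        split_ifs with h
        · rfl
        · rw [not_not.1 h, zero_mul]

variable {Ω : Set (Eu d)}

/-! ### Integrals over finite families of sets -/

theorem sum_setIntegral_eq_setIntegral_biUnion {X ι : Type*} [MeasurableSpace X] {μ : Measure X}
    (s : Finset ι) {A : ι → Set X} (hA : ∀ i ∈ s, MeasurableSet (A i))
    (hdisj : ∀ i ∈ s, ∀ j ∈ s, i ≠ j → μ (A i ∩ A j) = 0) {f : X → ℝ}
    (hf : IntegrableOn f (⋃ i ∈ s, A i) μ) :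
    ∑ i ∈ s, ∫ x in A i, f x ∂μ = ∫ x in ⋃ i ∈ s, A i, f x ∂μ := by
  have hU : ⋃ i ∈ s, A i = ⋃ i : s, A i := by
    ext x; simp
  rw [hU] at hf ⊢
  rw [integral_iUnion_ae (s := fun i : s => A i) (fun i => (hA i i.2).nullMeasurableSet)
    (fun i j hij => hdisj i i.2 j j.2 fun h => hij (Subtype.ext h)) hf, tsum_fintype,
    Finset.sum_coe_sort s fun i => ∫ x in A i, f x ∂μ]

/-- If `g` varies by at most `e` between `A` and `B`, its means over `A` and over `B`, taken with
respect to possibly different measures, differ by at most `e`. Stated after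
multiplication by the measure of `A`, which may vanish. -/
theorem abs_setIntegral_sub_le {X : Type*} [MeasurableSpace X] {μ ν : Measure X}
    {A B : Set X} (hA : μ A ≠ ⊤) (hB : ν B ≠ ⊤) (hB0 : 0 < ν.real B)
    {g : X → ℝ} (hgA : IntegrableOn g A μ) (hgB : IntegrableOn g B ν)
    {e : ℝ} (he : ∀ y ∈ A, ∀ z ∈ B, |g y - g z| ≤ e) :
    |∫ y in A, g y ∂μ - μ.real A / ν.real B * ∫ z in B, g z ∂ν| ≤ e * μ.real A := by
  set c : ℝ := (∫ z in B, g z ∂ν) / ν.real B with hc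
  have h1 : ∀ y ∈ A, ‖g y - c‖ ≤ e := by
    intro y hy
    have h2 : ∫ z in B, (g y - g z) ∂ν = ν.real B * (g y - c) := by
      have hk : IntegrableOn (fun _ => g y) B ν := integrableOn_const hB
      rw [integral_sub hk hgB, setIntegral_const, smul_eq_mul, hc]
      field_simp
    have h3 := norm_setIntegral_le_of_norm_le_const (f := fun z => g y - g z) hB.lt_top (he y hy)
    rw [h2, norm_mul, Real.norm_of_nonneg hB0.le, mul_comm] at h3
    exact le_of_mul_le_mul_right h3 hB0
  have h4 := norm_setIntegral_le_of_norm_le_const hA.lt_top h1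
  have hk : IntegrableOn (fun _ => c) A μ := integrableOn_const hA
  rw [integral_sub hgA hk, setIntegral_const, smul_eq_mul, hc] at h4
  rwa [← Real.norm_eq_abs, div_mul_eq_mul_div, mul_div_assoc]

/-! ### Geometry of the mesh -/

theorem nonempty_of_faceMeasure_pos {σ : Set (Eu d)} (h : 0 < faceMeasure σ) : σ.Nonempty := by
  rw [Set.nonempty_iff_ne_empty]
  rintro rfl
  simp [faceMeasure] at h

theorem euclideanHausdorffMeasure_ne_top_of_faceMeasure_pos {σ : Set (Eu d)}
    (h : 0 < faceMeasure σ) :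
    Measure.euclideanHausdorffMeasure (X := Eu d) (d - 1) σ ≠ ⊤ := by
  intro h'
  simp [faceMeasure, Measure.real, h'] at h

/-- Two non-overlapping cells have opposite outward normals along a common face: both contain a
half-ball centred at some point of the face, and two such half-balls overlap unless they are
opposite. -/
theorem IsOutwardUnitNormal.eq_neg {K L σ : Set (Eu d)} {n m : Eu d}
    (hσ : 0 < faceMeasure σ) (hKL : volume (K ∩ L) = 0)
    (hn : IsOutwardUnitNormal K σ n) (hm : IsOutwardUnitNormal L σ m) : m = -n := by
  have hne : NeBot (ae ((Measure.euclideanHausdorffMeasure (X := Eu d) (d - 1)).restrict σ)) := by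
    rw [ae_neBot, Ne, Measure.restrict_eq_zero]
    intro h
    simp [faceMeasure, Measure.real, h] at hσ
  obtain ⟨x, ⟨ε, hε, hK, -⟩, δ, hδ, hL, -⟩ := (hn.outward.and hm.outward).exists
  by_contra hmn
  have hpos : 0 < 1 + inner ℝ n m := by
    have h1 : -1 ≤ inner ℝ n m := by
      have := neg_le_of_abs_le (abs_real_inner_le_norm n m)
      rwa [hn.norm_eq_one, hm.norm_eq_one, one_mul] at this
    have h2 : inner ℝ n m ≠ -1 := fun h => hmn <| by
      have := (inner_eq_neg_one_iff_of_norm_eq_one hn.norm_eq_one hm.norm_eq_one).1 h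
      rw [this, neg_neg]
    have := lt_of_le_of_ne h1 (Ne.symm h2)
    linarith
  set U : Set (Eu d) := (Metric.ball x ε ∩ Metric.ball x δ) ∩
    ({y | inner ℝ n (y - x) < 0} ∩ {y | inner ℝ m (y - x) < 0}) with hU
  have hUo : IsOpen U := (Metric.isOpen_ball.inter Metric.isOpen_ball).inter
    ((isOpen_lt (by fun_prop) continuous_const).inter (isOpen_lt (by fun_prop) continuous_const))
  have hUe : U = ∅ := by
    refine (hUo.measure_eq_zero_iff volume).1 (measure_mono_null ?_ hKL)
    exact fun y hy => ⟨hK y hy.1.1 hy.2.1, hL y hy.1.2 hy.2.2⟩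
  -- points slightly off `x` in the direction `-(n + m)` lie in both half-balls
  have hlim : Tendsto (fun t : ℝ => x - t • (n + m)) (𝓝[>] 0) (𝓝 x) := by
    have : Tendsto (fun t : ℝ => x - t • (n + m)) (𝓝 0) (𝓝 (x - (0 : ℝ) • (n + m))) :=
      (by fun_prop : Continuous fun t : ℝ => x - t • (n + m)).tendsto 0
    rw [zero_smul, sub_zero] at this
    exact this.mono_left nhdsWithin_le_nhds
  obtain ⟨t, ht, ht0⟩ := ((hlim.eventually ((Metric.isOpen_ball.inter Metric.isOpen_ball).mem_nhds
    ⟨Metric.mem_ball_self hε, Metric.mem_ball_self hδ⟩)).and self_mem_nhdsWithin).exists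
  have ht0 : 0 < t := ht0
  have hmem : x - t • (n + m) ∈ U := by
    refine ⟨ht, ?_, ?_⟩
    · change inner ℝ n (x - t • (n + m) - x) < 0
      rw [sub_sub_cancel_left, inner_neg_right, inner_smul_right, inner_add_right,
        real_inner_self_eq_norm_sq, hn.norm_eq_one]
      have := mul_pos ht0 hpos
      linarith
    · change inner ℝ m (x - t • (n + m) - x) < 0
      rw [sub_sub_cancel_left, inner_neg_right, inner_smul_right, inner_add_right,
        real_inner_self_eq_norm_sq, hm.norm_eq_one, real_inner_comm]
      have := mul_pos ht0 hpos
      linarith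
  rw [hUe] at hmem
  exact hmem

namespace PolyhedralMesh

variable (M : PolyhedralMesh Ω)

theorem mem_allFaces {σ : Set (Eu d)} : σ ∈ M.allFaces ↔ ∃ K ∈ M.cells, σ ∈ M.faces K := by
  simp [allFaces]

variable {M}

theorem isBounded_cell (hΩ : Bornology.IsBounded Ω) {K : Set (Eu d)} (hK : K ∈ M.cells) :
    Bornology.IsBounded K := hΩ.closure.subset (M.cell_subset K hK)

theorem diam_le_size {K : Set (Eu d)} (hK : K ∈ M.cells) : Metric.diam K ≤ M.size :=
  le_ciSup (f := fun K : M.cells => Metric.diam (K : Set (Eu d))) (Set.finite_range _).bddAbove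
    ⟨K, hK⟩

theorem size_nonneg : 0 ≤ M.size := Real.iSup_nonneg fun _ => Metric.diam_nonneg

theorem dist_le_size (hΩ : Bornology.IsBounded Ω) {K : Set (Eu d)} (hK : K ∈ M.cells) {y z : Eu d}
    (hy : y ∈ closure K) (hz : z ∈ closure K) : dist y z ≤ M.size :=
  (Metric.dist_le_diam_of_mem (isBounded_cell hΩ hK).closure hy hz).trans
    ((Metric.diam_closure K).trans_le (diam_le_size hK))

theorem face_subset_closure {K σ : Set (Eu d)} (hK : K ∈ M.cells) (hσ : σ ∈ M.faces K) :
    σ ⊆ closure K := by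
  refine subset_trans ?_ frontier_subset_closure
  rw [M.frontier_cell K hK]
  exact Set.subset_biUnion_of_mem (u := fun τ => τ) hσ

theorem Separates.normal_eq_neg {σ K L : Set (Eu d)} (h : M.Separates σ K L) :
    M.normal L σ = -M.normal K σ :=
  (M.normal_spec K h.1 σ h.2.2.2.1).eq_neg (M.face_pos K h.1 σ h.2.2.2.1)
    (M.cells_disjoint K h.1 L h.2.1 h.2.2.1) (M.normal_spec L h.2.1 σ h.2.2.2.2)

/-- A face belongs to at most two cells: the outward normals of three cells would be pairwise
opposite. -/
theorem Separates.eq_or_eq {σ K L P : Set (Eu d)} (h : M.Separates σ K L) (hP : P ∈ M.cells)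
    (hσ : σ ∈ M.faces P) : P = K ∨ P = L := by
  by_contra hne
  push Not at hne
  have h1 := h.normal_eq_neg
  have h2 : M.normal P σ = -M.normal K σ :=
    Separates.normal_eq_neg ⟨h.1, hP, hne.1.symm, h.2.2.2.1, hσ⟩
  have h3 : M.normal P σ = -M.normal L σ :=
    Separates.normal_eq_neg ⟨h.2.1, hP, hne.2.symm, h.2.2.2.2, hσ⟩
  have h4 := (M.normal_spec K h.1 σ h.2.2.2.1).norm_eq_one
  rw [h2, h1, neg_neg] at h3
  have h5 : (2 : ℝ) • M.normal K σ = 0 := by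
    rw [two_smul, add_eq_zero_iff_neg_eq, h3]
  rw [(smul_eq_zero.1 h5).resolve_left two_ne_zero, norm_zero] at h4
  exact zero_ne_one h4

theorem subset_frontier_of_not_isInterior {σ K : Set (Eu d)} (hK : K ∈ M.cells)
    (hσ : σ ∈ M.faces K) (h : ¬ M.IsInterior σ) : σ ⊆ frontier Ω := by
  refine M.exterior_face K hK σ hσ fun L hL hσL => ?_
  by_contra hne
  exact h ⟨K, L, hK, hL, Ne.symm hne, hσ, hσL⟩

end PolyhedralMesh

open PolyhedralMesh

variable {M : PolyhedralMesh Ω}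

/-! ### The discrete gradient -/

section DiscreteGradient

variable (D : DualMesh M) (x : Set (Eu d) → Eu d) (φ : Eu d → ℝ)

theorem faceGradient_of_isInterior {σ : Set (Eu d)} (h : M.IsInterior σ) :
    ∃ K L, M.Separates σ K L ∧ faceGradient D x φ σ =
      (faceMeasure σ / volume.real (D.dualCell σ) * (φ (x L) - φ (x K))) • M.normal K σ := by
  refine ⟨h.choose, h.choose_spec.choose, h.choose_spec.choose_spec, ?_⟩
  rw [faceGradient, dif_pos h]

theorem faceGradient_of_not_isInterior {σ : Set (Eu d)} (h : ¬ M.IsInterior σ) :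
    faceGradient D x φ σ = 0 := by
  rw [faceGradient, dif_neg h]

theorem le_meshRegularity {σ K L : Set (Eu d)} (h : M.Separates σ K L) :
    faceMeasure σ * ‖x L - x K‖ / volume.real (D.dualCell σ) ≤ meshRegularity D x := by
  classical
  refine le_csSup (Set.Finite.bddAbove ?_) ⟨σ, K, L, h, rfl⟩
  refine ((M.allFaces ×ˢ M.cells ×ˢ M.cells).finite_toSet.image
    fun q => faceMeasure q.1 * ‖x q.2.2 - x q.2.1‖ / volume.real (D.dualCell q.1)).subset ?_
  rintro r ⟨σ, K, L, h, rfl⟩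
  refine ⟨(σ, K, L), ?_, rfl⟩
  simp only [Finset.coe_product, Set.mem_prod, Finset.mem_coe]
  exact ⟨(mem_allFaces M).2 ⟨K, h.1, h.2.2.2.1⟩, h.1, h.2.1⟩

theorem meshRegularity_nonneg : 0 ≤ meshRegularity D x := by
  refine Real.sSup_nonneg ?_
  rintro _ ⟨σ, K, L, -, rfl⟩
  exact div_nonneg (mul_nonneg measureReal_nonneg (norm_nonneg _)) measureReal_nonneg

/-- The bound on the discrete gradient, which is where the regularity of the mesh enters. -/
theorem norm_faceGradient_le {C : NNReal} (hφ : LipschitzWith C φ) {θ : ℝ}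
    (hθ : meshRegularity D x ≤ θ) (σ : Set (Eu d)) : ‖faceGradient D x φ σ‖ ≤ C * θ := by
  have hθ0 : 0 ≤ θ := (meshRegularity_nonneg D x).trans hθ
  by_cases h : M.IsInterior σ
  · obtain ⟨K, L, hKL, heq⟩ := faceGradient_of_isInterior D x φ h
    have hr : 0 ≤ faceMeasure σ / volume.real (D.dualCell σ) :=
      div_nonneg measureReal_nonneg measureReal_nonneg
    rw [heq, norm_smul, (M.normal_spec K hKL.1 σ hKL.2.2.2.1).norm_eq_one, mul_one, norm_mul,
      Real.norm_of_nonneg hr]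
    calc faceMeasure σ / volume.real (D.dualCell σ) * ‖φ (x L) - φ (x K)‖
        ≤ faceMeasure σ / volume.real (D.dualCell σ) * (C * ‖x L - x K‖) := by
          gcongr
          exact hφ.norm_sub_le _ _
      _ = C * (faceMeasure σ * ‖x L - x K‖ / volume.real (D.dualCell σ)) := by ring
      _ ≤ C * θ := by
          gcongr
          exact (le_meshRegularity D x hKL).trans hθ
  · rw [faceGradient_of_not_isInterior D x φ h, norm_zero]
    positivity

theorem measurable_discreteGradient : Measurable (discreteGradient D x φ) :=
  Finset.measurable_fun_sum _ fun σ hσ =>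
    measurable_const.indicator (D.measurableSet_dualCell σ hσ)

theorem ae_norm_discreteGradient_le {C : NNReal} (hφ : LipschitzWith C φ) {θ : ℝ}
    (hθ : meshRegularity D x ≤ θ) : ∀ᵐ y, ‖discreteGradient D x φ y‖ ≤ C * θ := by
  have hθ0 : 0 ≤ θ := (meshRegularity_nonneg D x).trans hθ
  have hdis : ∀ᵐ y, ∀ σ ∈ M.allFaces, ∀ τ ∈ M.allFaces, σ ≠ τ →
      y ∉ D.dualCell σ ∩ D.dualCell τ := by
    rw [Finset.eventually_all]
    intro σ hσ
    rw [Finset.eventually_all]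
    intro τ hτ
    by_cases hne : σ = τ
    · exact Eventually.of_forall fun _ h => absurd hne h
    · filter_upwards [measure_eq_zero_iff_ae_notMem.1 (D.dualCells_disjoint σ hσ τ hτ hne)]
        with y hy _
      exact hy
  filter_upwards [hdis] with y hy
  by_cases h : ∃ σ ∈ M.allFaces, y ∈ D.dualCell σ
  · obtain ⟨σ, hσ, hyσ⟩ := h
    rw [discreteGradient, Finset.sum_eq_single_of_mem σ hσ, Set.indicator_of_mem hyσ]
    · exact norm_faceGradient_le D x φ hφ hθ σ
    · intro τ hτ hne
      exact Set.indicator_of_notMem (fun hyτ => hy τ hτ σ hσ hne ⟨hyτ, hyσ⟩) _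
  · push Not at h
    rw [discreteGradient, Finset.sum_eq_zero fun σ hσ => Set.indicator_of_notMem (h σ hσ) _,
      norm_zero]
    positivity

theorem volume_dualCell_ne_top (hΩ : Bornology.IsBounded Ω) {σ : Set (Eu d)}
    (hσ : σ ∈ M.allFaces) : volume (D.dualCell σ) ≠ ⊤ := by
  refine ((measure_mono (Finset.subset_set_biUnion_of_mem hσ)).trans_lt ?_).ne
  rw [measure_congr D.dualCells_cover]
  exact hΩ.measure_lt_top

theorem sum_volume_dualCell (hΩ : Bornology.IsBounded Ω) :
    ∑ σ ∈ M.allFaces, volume.real (D.dualCell σ) = volume.real Ω := by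
  have hfin : volume (⋃ σ ∈ M.allFaces, D.dualCell σ) ≠ ⊤ := by
    rw [measure_congr D.dualCells_cover]
    exact hΩ.measure_lt_top.ne
  have h := sum_setIntegral_eq_setIntegral_biUnion M.allFaces D.measurableSet_dualCell
    D.dualCells_disjoint (f := fun _ => (1 : ℝ)) (integrableOn_const hfin)
  simp only [setIntegral_const, smul_eq_mul, mul_one] at h
  rw [h, measureReal_congr D.dualCells_cover]

theorem setIntegral_inner_discreteGradient {g : Eu d → ℝ} (hg : Integrable g) (v : Eu d) :
    ∫ y in Ω, inner ℝ (discreteGradient D x φ y) (g y • v)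
      = ∑ σ ∈ M.allFaces, inner ℝ (faceGradient D x φ σ) v * ∫ y in D.dualCell σ, g y := by
  have h1 : ∀ y, inner ℝ (discreteGradient D x φ y) (g y • v) = ∑ σ ∈ M.allFaces,
      (D.dualCell σ).indicator (fun y => inner ℝ (faceGradient D x φ σ) v * g y) y := by
    intro y
    rw [discreteGradient, sum_inner]
    refine Finset.sum_congr rfl fun σ _ => ?_
    by_cases hy : y ∈ D.dualCell σ
    · rw [Set.indicator_of_mem hy, Set.indicator_of_mem hy, inner_smul_right, mul_comm]
    · rw [Set.indicator_of_notMem hy, Set.indicator_of_notMem hy, inner_zero_left]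
  simp only [h1]
  rw [integral_finsetSum]
  · refine Finset.sum_congr rfl fun σ hσ => ?_
    rw [← setIntegral_congr_set D.dualCells_cover,
      setIntegral_indicator (D.measurableSet_dualCell σ hσ),
      Set.inter_eq_right.2 (Finset.subset_set_biUnion_of_mem hσ), integral_const_mul]
  · intro σ hσ
    exact ((hg.const_mul _).indicator (D.measurableSet_dualCell σ hσ)).integrableOn

/-- Discrete integration by parts: the sum over the faces is rearranged cell by cell. An interior
face occurs in exactly two cells, with opposite normals. Here `I σ` stands for the integral of a
test function over `σ`. -/
theorem sum_inner_faceGradient_eq (hx : ∀ K ∈ M.cells, ∀ σ ∈ M.faces K, ¬ M.IsInterior σ →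
      φ (x K) = 0) (hΩ : Bornology.IsBounded Ω) (I : Set (Eu d) → ℝ) (v : Eu d) :
    ∑ σ ∈ M.allFaces, inner ℝ (faceGradient D x φ σ) v *
        (volume.real (D.dualCell σ) / faceMeasure σ * I σ)
      = - ∑ K ∈ M.cells, φ (x K) * ∑ σ ∈ M.faces K, inner ℝ (M.normal K σ) v * I σ := by
  classical
  have hswap : ∑ K ∈ M.cells, φ (x K) * ∑ σ ∈ M.faces K, inner ℝ (M.normal K σ) v * I σ
      = ∑ σ ∈ M.allFaces, ∑ K ∈ M.cells with σ ∈ M.faces K,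
        φ (x K) * (inner ℝ (M.normal K σ) v * I σ) := by
    simp only [Finset.mul_sum]
    refine Finset.sum_comm' fun K σ => ?_
    rw [Finset.mem_filter, mem_allFaces]
    exact ⟨fun h => ⟨h, K, h⟩, fun h => h.1⟩
  rw [hswap, ← Finset.sum_neg_distrib]
  refine Finset.sum_congr rfl fun σ hσ => ?_
  by_cases h : M.IsInterior σ
  · obtain ⟨K, L, hKL, heq⟩ := faceGradient_of_isInterior D x φ h
    have hpair : M.cells.filter (fun P => σ ∈ M.faces P) = {K, L} := by
      ext P
      simp only [Finset.mem_filter, Finset.mem_insert, Finset.mem_singleton]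
      constructor
      · exact fun hP => hKL.eq_or_eq hP.1 hP.2
      · rintro (rfl | rfl)
        · exact ⟨hKL.1, hKL.2.2.2.1⟩
        · exact ⟨hKL.2.1, hKL.2.2.2.2⟩
    have hσ0 : faceMeasure σ ≠ 0 := (M.face_pos K hKL.1 σ hKL.2.2.2.1).ne'
    have hD0 : volume.real (D.dualCell σ) ≠ 0 :=
      (ENNReal.toReal_pos (D.dualCell_pos σ h).ne' (volume_dualCell_ne_top D hΩ hσ)).ne'
    rw [hpair, Finset.sum_pair hKL.2.2.1, hKL.normal_eq_neg, inner_neg_left, heq,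
      inner_smul_left]
    simp only [conj_trivial]
    field_simp
    ring
  · rw [faceGradient_of_not_isInterior D x φ h, inner_zero_left, zero_mul, zero_eq_neg]
    refine Finset.sum_eq_zero fun K hK => ?_
    rw [Finset.mem_filter] at hK
    rw [hx K hK.1 σ hK.2 h, zero_mul]

end DiscreteGradient

/-! ### Convergence against smooth and integrable fields -/

/-- Replacing in the tested discrete gradient the mean of `g` over `D_σ` by its mean over `σ` costs
`O(h)`, because `D_σ` and `σ` both lie in the closures of the two cells adjacent to `σ`. -/
theorem abs_setIntegral_inner_discreteGradient_sub_le (D : DualMesh M) (x : Set (Eu d) → Eu d)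
    (hΩ : Bornology.IsBounded Ω) {φ : Eu d → ℝ} {C : NNReal} (hφ : LipschitzWith C φ) {θ : ℝ}
    (hθ : meshRegularity D x ≤ θ) {g : Eu d → ℝ} (hg : Continuous g) (hgc : HasCompactSupport g)
    {C' : NNReal} (hgL : LipschitzWith C' g) {v : Eu d} (hv : ‖v‖ = 1) :
    |(∫ y in Ω, inner ℝ (discreteGradient D x φ y) (g y • v))
      - ∑ σ ∈ M.allFaces, inner ℝ (faceGradient D x φ σ) v *
        (volume.real (D.dualCell σ) / faceMeasure σ *
          ∫ y in σ, g y ∂Measure.euclideanHausdorffMeasure (d - 1))|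
      ≤ C * θ * (C' * M.size) * volume.real Ω := by
  have hθ0 : 0 ≤ θ := (meshRegularity_nonneg D x).trans hθ
  have hgi : Integrable g := hg.integrable_of_hasCompactSupport hgc
  obtain ⟨B, hB⟩ := hgc.exists_bound_of_continuous hg
  rw [setIntegral_inner_discreteGradient D x φ hgi, ← Finset.sum_sub_distrib,
    ← sum_volume_dualCell D hΩ, Finset.mul_sum]
  refine (Finset.abs_sum_le_sum_abs _ _).trans (Finset.sum_le_sum fun σ hσ => ?_)
  rw [← mul_sub, abs_mul]
  by_cases h : M.IsInterior σ
  · obtain ⟨K, L, hKL⟩ := id h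
    have hσp := M.face_pos K hKL.1 σ hKL.2.2.2.1
    have hσt := euclideanHausdorffMeasure_ne_top_of_faceMeasure_pos hσp
    have h1 : |inner ℝ (faceGradient D x φ σ) v| ≤ C * θ := by
      have := abs_real_inner_le_norm (faceGradient D x φ σ) v
      rw [hv, mul_one] at this
      exact this.trans (norm_faceGradient_le D x φ hφ hθ σ)
    have h2 := abs_setIntegral_sub_le (volume_dualCell_ne_top D hΩ hσ) hσt hσp
      (hgi.integrableOn (s := D.dualCell σ))
      (Measure.integrableOn_of_bounded hσt hg.aestronglyMeasurable (Eventually.of_forall hB))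
      (e := C' * M.size) (by
        intro y hy z hz
        have hdist : dist y z ≤ M.size := by
          rcases D.dualCell_subset σ K L hKL hy with hy | hy
          · exact dist_le_size hΩ hKL.1 hy (face_subset_closure hKL.1 hKL.2.2.2.1 hz)
          · exact dist_le_size hΩ hKL.2.1 hy (face_subset_closure hKL.2.1 hKL.2.2.2.2 hz)
        calc |g y - g z| = dist (g y) (g z) := (Real.dist_eq _ _).symm
          _ ≤ C' * dist y z := hgL.dist_le_mul y z
          _ ≤ C' * M.size := by gcongr)
    calc _ ≤ (C * θ) * (C' * M.size * volume.real (D.dualCell σ)) :=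
          mul_le_mul h1 h2 (abs_nonneg _) (by positivity)
      _ = _ := by ring
  · rw [faceGradient_of_not_isInterior D x φ h, inner_zero_left, abs_zero, zero_mul]
    have := size_nonneg (M := M)
    positivity

/-- On a fine mesh, `φ` vanishes at the points of the cells that have a face on `∂Ω`, so that the
exterior faces do not contribute to the discrete integration by parts. -/
theorem apply_eq_zero_of_exterior_face {x : Set (Eu d) → Eu d} (hx : ∀ K ∈ M.cells, x K ∈ K)
    (hΩo : IsOpen Ω) (hΩ : Bornology.IsBounded Ω) {φ : Eu d → ℝ} {δ : ℝ}
    (hδ : Metric.thickening δ (tsupport φ) ⊆ Ω) (hsize : M.size < δ) {K σ : Set (Eu d)}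
    (hK : K ∈ M.cells) (hσ : σ ∈ M.faces K) (hint : ¬ M.IsInterior σ) : φ (x K) = 0 := by
  by_contra hne
  obtain ⟨z, hz⟩ := nonempty_of_faceMeasure_pos (M.face_pos K hK σ hσ)
  have hzf := subset_frontier_of_not_isInterior hK hσ hint hz
  have hzΩ : z ∈ Ω := hδ (Metric.mem_thickening_iff.2 ⟨x K, subset_tsupport φ hne,
    (dist_le_size hΩ hK (face_subset_closure hK hσ hz) (subset_closure (hx K hK))).trans_lt hsize⟩)
  rw [hΩo.frontier_eq] at hzf
  exact hzf.2 hzΩ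

/-- Quadrature error of the points `x_K`. -/
theorem abs_sum_mul_setIntegral_sub_le {x : Set (Eu d) → Eu d} (hx : ∀ K ∈ M.cells, x K ∈ K)
    (hΩ : Bornology.IsBounded Ω) {φ : Eu d → ℝ} {C : NNReal} (hφ : LipschitzWith C φ)
    (hφΩ : tsupport φ ⊆ Ω) {w : Eu d → ℝ} (hw : Integrable w)
    (hφw : Integrable fun y => φ y * w y) :
    |(∑ K ∈ M.cells, φ (x K) * ∫ y in K, w y) - ∫ y, φ y * w y|
      ≤ C * M.size * ∫ y, |w y| := by
  -- the cells cover the support of `φ` up to a null set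
  have hcells : ∫ y, φ y * w y = ∑ K ∈ M.cells, ∫ y in K, φ y * w y := by
    rw [sum_setIntegral_eq_setIntegral_biUnion M.cells (A := fun K => K) M.measurableSet_cell
      M.cells_disjoint hφw.integrableOn]
    symm
    refine setIntegral_eq_integral_of_ae_compl_eq_zero ?_
    filter_upwards [measure_eq_zero_iff_ae_notMem.1 M.cells_cover] with y hy hyU
    have : y ∉ tsupport φ := fun h => hy ⟨hφΩ h, hyU⟩
    rw [image_eq_zero_of_notMem_tsupport this, zero_mul]
  rw [hcells, ← Finset.sum_sub_distrib]
  calc |∑ K ∈ M.cells, (φ (x K) * (∫ y in K, w y) - ∫ y in K, φ y * w y)|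
      ≤ ∑ K ∈ M.cells, C * M.size * ∫ y in K, |w y| := by
        refine (Finset.abs_sum_le_sum_abs _ _).trans (Finset.sum_le_sum fun K hK => ?_)
        rw [← integral_const_mul, ← integral_sub (hw.integrableOn.const_mul _) hφw.integrableOn,
          ← integral_const_mul]
        rw [← Real.norm_eq_abs]
        refine norm_integral_le_of_norm_le (hw.abs.integrableOn.const_mul _) ?_
        filter_upwards [ae_restrict_mem (M.measurableSet_cell K hK)] with y hy
        rw [← sub_mul, norm_mul, Real.norm_eq_abs (w y)]
        gcongr
        calc ‖φ (x K) - φ y‖ = dist (φ (x K)) (φ y) := (dist_eq_norm _ _).symm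
          _ ≤ C * dist (x K) y := hφ.dist_le_mul _ _
          _ ≤ C * M.size := by
            gcongr
            exact dist_le_size hΩ hK (subset_closure (hx K hK)) (subset_closure hy)
    _ = C * M.size * ∫ y in ⋃ K ∈ M.cells, K, |w y| := by
        rw [← Finset.mul_sum, sum_setIntegral_eq_setIntegral_biUnion M.cells (A := fun K => K)
          M.measurableSet_cell M.cells_disjoint hw.abs.integrableOn]
    _ ≤ C * M.size * ∫ y, |w y| := by
        have := size_nonneg (M := M)
        refine mul_le_mul_of_nonneg_left ?_ (by positivity)
        exact setIntegral_le_integral hw.abs (Eventually.of_forall fun y => abs_nonneg _)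

theorem gradient_eq_zero_of_notMem {φ : Eu d → ℝ} (hφΩ : tsupport φ ⊆ Ω) {y : Eu d} (hy : y ∉ Ω) :
    gradient φ y = 0 := by
  have h : fderiv ℝ φ y = 0 :=
    image_eq_zero_of_notMem_tsupport fun h => hy (hφΩ (tsupport_fderiv_subset ℝ h))
  rw [gradient, h, map_zero]

/-- Convergence against the fields `g • v` with `g` smooth: up to `O(h)`, the tested discrete
gradient is `-∑ K, φ (x K) * ∫ y in K, ∂_v g`, hence `-∫ φ * ∂_v g`, which is `∫ ∂_v φ * g`. -/
theorem tendsto_setIntegral_inner_smul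
    (hΩo : IsOpen Ω) (hΩ : Bornology.IsBounded Ω) (M : ℕ → PolyhedralMesh Ω)
    (D : ∀ m, (M m).DualMesh) (x : ℕ → Set (Eu d) → Eu d)
    (hx : ∀ m, ∀ K ∈ (M m).cells, x m K ∈ K)
    (hsize : Tendsto (fun m => (M m).size) atTop (𝓝 0))
    (θ : ℝ) (hθ : ∀ m, meshRegularity (D m) (x m) ≤ θ)
    {φ : Eu d → ℝ} (hφ : ContDiff ℝ ∞ φ) (hφc : HasCompactSupport φ)
    (hφΩ : tsupport φ ⊆ Ω) {g : Eu d → ℝ} (hg : ContDiff ℝ ∞ g) (hgc : HasCompactSupport g)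
    {v : Eu d} (hv : ‖v‖ = 1) :
    Tendsto (fun m => ∫ y in Ω, inner ℝ (discreteGradient (D m) (x m) φ y) (g y • v))
      atTop (𝓝 (∫ y in Ω, inner ℝ (gradient φ y) (g y • v))) := by
  obtain ⟨C, hC⟩ := hφ.lipschitzWith_of_hasCompactSupport hφc (by simp)
  obtain ⟨C', hC'⟩ := hg.lipschitzWith_of_hasCompactSupport hgc (by simp)
  obtain ⟨δ, hδ, hδΩ⟩ := hφc.isCompact.exists_thickening_subset_open hΩo hφΩ
  have hφv : Continuous fun y => fderiv ℝ φ y v :=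
    (hφ.continuous_fderiv (by simp)).clm_apply continuous_const
  have hgv : Continuous fun y => fderiv ℝ g y v :=
    (hg.continuous_fderiv (by simp)).clm_apply continuous_const
  have hw : Integrable fun y => fderiv ℝ g y v :=
    hgv.integrable_of_hasCompactSupport (hgc.fderiv_apply ℝ v)
  have hφw : Integrable fun y => φ y * fderiv ℝ g y v :=
    (hφ.continuous.mul hgv).integrable_of_hasCompactSupport hφc.mul_right
  have htarget : ∫ y in Ω, inner ℝ (gradient φ y) (g y • v) = -∫ y, φ y * fderiv ℝ g y v := by
    rw [integral_mul_fderiv_eq_neg_fderiv_mul_of_integrable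
      ((hφv.mul hg.continuous).integrable_of_hasCompactSupport hgc.mul_left) hφw
      ((hφ.continuous.mul hg.continuous).integrable_of_hasCompactSupport hgc.mul_left)
      (fun y _ => hφ.differentiable (by simp) y) (fun y _ => hg.differentiable (by simp) y),
      neg_neg,
      setIntegral_eq_integral_of_forall_compl_eq_zero fun y hy => by
        rw [gradient_eq_zero_of_notMem hφΩ hy, inner_zero_left]]
    refine integral_congr_ae (Eventually.of_forall fun y => ?_)
    simp only [inner_smul_right, inner_gradient_left]
    ring
  set A : ℝ := C * θ * C' * volume.real Ω + C * ∫ y, |fderiv ℝ g y v| with hA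
  have hbound : ∀ᶠ m in atTop,
      ‖(∫ y in Ω, inner ℝ (discreteGradient (D m) (x m) φ y) (g y • v))
        - ∫ y in Ω, inner ℝ (gradient φ y) (g y • v)‖ ≤ A * (M m).size := by
    filter_upwards [hsize.eventually (gt_mem_nhds hδ)] with m hm
    have h1 := abs_setIntegral_inner_discreteGradient_sub_le (D m) (x m) hΩ hC (hθ m)
      hg.continuous hgc hC' hv
    rw [sum_inner_faceGradient_eq (D m) (x m) φ (fun K hK σ hσ hint =>
      apply_eq_zero_of_exterior_face (hx m) hΩo hΩ hδΩ hm hK hσ hint) hΩ] at h1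
    have hdiv : ∑ K ∈ (M m).cells, φ (x m K) * ∑ σ ∈ (M m).faces K, inner ℝ ((M m).normal K σ) v *
          ∫ y in σ, g y ∂Measure.euclideanHausdorffMeasure (d - 1)
        = ∑ K ∈ (M m).cells, φ (x m K) * ∫ y in K, fderiv ℝ g y v := by
      refine Finset.sum_congr rfl fun K hK => ?_
      rw [integral_fderiv_eq_sum_faces ((M m).measurableSet_cell K hK) (isBounded_cell hΩ hK)
        ((M m).measurableSet_face K hK) ((M m).face_pos K hK) ((M m).frontier_cell K hK)
        ((M m).faces_disjoint K hK) ((M m).normal_spec K hK) (hg.of_le (by simp)) hgc hv]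
    rw [hdiv] at h1
    have h2 := abs_sum_mul_setIntegral_sub_le (hx m) hΩ hC hφΩ hw hφw
    rw [htarget, Real.norm_eq_abs]
    have h3 : ∀ a b c : ℝ, |a - -c| ≤ |a - -b| + |b - c| := by
      intro a b c
      calc |a - -c| = |(a - -b) - (b - c)| := by ring_nf
        _ ≤ _ := abs_sub _ _
    refine (h3 _ _ _).trans ((add_le_add h1 h2).trans_eq ?_)
    rw [hA]; ring
  rw [tendsto_iff_norm_sub_tendsto_zero]
  refine squeeze_zero' (Eventually.of_forall fun _ => norm_nonneg _) hbound ?_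
  simpa using hsize.const_mul A

/-- A uniformly bounded sequence that converges when tested against smooth compactly supported
fields converges when tested against integrable fields. -/
theorem tendsto_integral_inner_of_contDiff {μ : Measure (Eu d)} [IsFiniteMeasureOnCompacts μ]
    {F : ℕ → Eu d → Eu d} {G : Eu d → Eu d} {C : ℝ}
    (hFm : ∀ m, AEStronglyMeasurable (F m) μ) (hGm : AEStronglyMeasurable G μ)
    (hF : ∀ m, ∀ᵐ y ∂μ, ‖F m y‖ ≤ C) (hG : ∀ᵐ y ∂μ, ‖G y‖ ≤ C)
    (h : ∀ g : Eu d → Eu d, ContDiff ℝ ∞ g → HasCompactSupport g →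
      Tendsto (fun m => ∫ y, inner ℝ (F m y) (g y) ∂μ) atTop (𝓝 (∫ y, inner ℝ (G y) (g y) ∂μ)))
    {ψ : Eu d → Eu d} (hψ : Integrable ψ μ) :
    Tendsto (fun m => ∫ y, inner ℝ (F m y) (ψ y) ∂μ) atTop (𝓝 (∫ y, inner ℝ (G y) (ψ y) ∂μ)) := by
  have hint : ∀ {H f : Eu d → Eu d}, AEStronglyMeasurable H μ → (∀ᵐ y ∂μ, ‖H y‖ ≤ C) →
      Integrable f μ → Integrable (fun y => inner ℝ (H y) (f y)) μ := by
    intro H f hHm hH hf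
    refine (hf.norm.const_mul C).mono' (hHm.inner hf.aestronglyMeasurable) ?_
    filter_upwards [hH] with y hy
    exact (norm_inner_le_norm _ _).trans (by gcongr)
  have hle : ∀ {H f g : Eu d → Eu d}, AEStronglyMeasurable H μ → (∀ᵐ y ∂μ, ‖H y‖ ≤ C) →
      Integrable f μ → Integrable g μ →
      |∫ y, inner ℝ (H y) (f y) ∂μ - ∫ y, inner ℝ (H y) (g y) ∂μ| ≤ C * ∫ y, ‖f y - g y‖ ∂μ := by
    intro H f g hHm hH hf hg
    rw [← integral_sub (hint hHm hH hf) (hint hHm hH hg), ← integral_const_mul,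
      ← Real.norm_eq_abs]
    refine norm_integral_le_of_norm_le ((hf.sub hg).norm.const_mul C) ?_
    filter_upwards [hH] with y hy
    rw [← inner_sub_right]
    exact (norm_inner_le_norm _ _).trans (by gcongr)
  rw [Metric.tendsto_atTop]
  intro ε hε
  set η : ℝ := ε / (3 * (|C| + 1)) with hη
  have hη0 : 0 < η := by positivity
  obtain ⟨g, hgc, hg, hgψ⟩ := (memLp_one_iff_integrable.2 hψ).exist_eLpNorm_sub_le
    ENNReal.one_ne_top le_rfl hη0
  have hgi : Integrable g μ := hg.continuous.integrable_of_hasCompactSupport hgc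
  have hsmall : C * ∫ y, ‖ψ y - g y‖ ∂μ < ε / 3 := by
    have h1 : ∫ y, ‖ψ y - g y‖ ∂μ ≤ η := by
      rw [integral_norm_eq_lintegral_enorm (f := fun y => ψ y - g y)
        (hψ.sub hgi).aestronglyMeasurable]
      rw [eLpNorm_one_eq_lintegral_enorm] at hgψ
      exact ENNReal.toReal_le_of_le_ofReal hη0.le hgψ
    calc C * ∫ y, ‖ψ y - g y‖ ∂μ ≤ |C| * η := by
          gcongr
          exact le_abs_self C
      _ < (|C| + 1) * η := by gcongr; linarith
      _ = ε / 3 := by rw [hη]; field_simp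
  obtain ⟨N, hN⟩ := Metric.tendsto_atTop.1 (h g hg hgc) (ε / 3) (by positivity)
  refine ⟨N, fun m hm => ?_⟩
  have h1 := hle (hFm m) (hF m) hψ hgi
  have h2 := hle hGm hG hψ hgi
  have h3 := hN m hm
  rw [Real.dist_eq] at h3 ⊢
  rw [abs_lt] at h3 ⊢
  rw [abs_le] at h1 h2
  constructor <;> linarith

end WeakGradient

end

theorem lemma3p1 {d : ℕ} (hd : 1 ≤ d) {Ω : Set (WeakGradient.Eu d)}
    (hΩ : WeakGradient.IsPolyhedralDomain Ω)
    (M : ℕ → WeakGradient.PolyhedralMesh Ω)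
    (D : ∀ m, (M m).DualMesh)
    (x : ℕ → Set (WeakGradient.Eu d) → WeakGradient.Eu d)
    (hx : ∀ m, ∀ K ∈ (M m).cells, x m K ∈ K)
    (hsize : Tendsto (fun m => (M m).size) atTop (𝓝 0))
    (θ : ℝ) (hθ : ∀ m, WeakGradient.meshRegularity (D m) (x m) ≤ θ)
    (φ : WeakGradient.Eu d → ℝ) (hφ : ContDiff ℝ ∞ φ) (hφc : HasCompactSupport φ)
    (hφΩ : tsupport φ ⊆ Ω) :
    (∀ m, MemLp (WeakGradient.discreteGradient (D m) (x m) φ) ⊤ (volume.restrict Ω)) ∧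
    (∃ C : ℝ, ∀ m, eLpNorm (WeakGradient.discreteGradient (D m) (x m) φ) ⊤
      (volume.restrict Ω) ≤ ENNReal.ofReal C) ∧
    MemLp (gradient φ) ⊤ (volume.restrict Ω) ∧
    (∀ ψ : WeakGradient.Eu d → WeakGradient.Eu d, Integrable ψ (volume.restrict Ω) →
      Tendsto (fun m => ∫ y in Ω, inner ℝ (WeakGradient.discreteGradient (D m) (x m) φ y) (ψ y))
        atTop (𝓝 (∫ y in Ω, inner ℝ (gradient φ y) (ψ y)))) := by
  obtain ⟨L, hL⟩ := hφ.lipschitzWith_of_hasCompactSupport hφc (by simp)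
  have hmeas : ∀ m, AEStronglyMeasurable (WeakGradient.discreteGradient (D m) (x m) φ)
      (volume.restrict Ω) :=
    fun m => (WeakGradient.measurable_discreteGradient (D m) (x m) φ).aestronglyMeasurable
  have hbd : ∀ m, ∀ᵐ y ∂volume.restrict Ω,
      ‖WeakGradient.discreteGradient (D m) (x m) φ y‖ ≤ L * θ :=
    fun m => ae_restrict_of_ae (WeakGradient.ae_norm_discreteGradient_le (D m) (x m) φ hL (hθ m))
  have hgrad : Continuous (gradient φ) :=
    (InnerProductSpace.toDual ℝ (WeakGradient.Eu d)).symm.continuous.comp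
      (hφ.continuous_fderiv (by simp))
  have hgradL : ∀ y, ‖gradient φ y‖ ≤ L := fun y => by
    rw [gradient, LinearIsometryEquiv.norm_map]
    exact norm_fderiv_le_of_lipschitz ℝ hL
  refine ⟨fun m => memLp_top_of_bound (hmeas m) _ (hbd m), ⟨L * θ, fun m => ?_⟩,
    memLp_top_of_bound hgrad.aestronglyMeasurable L (Eventually.of_forall hgradL), fun ψ hψ => ?_⟩
  · rw [eLpNorm_exponent_top]
    exact eLpNormEssSup_le_of_ae_bound (hbd m)
  refine WeakGradient.tendsto_integral_inner_of_contDiff (C := max (L * θ) L) hmeas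
    hgrad.aestronglyMeasurable (fun m => (hbd m).mono fun y hy => hy.trans (le_max_left _ _))
    (Eventually.of_forall fun y => (hgradL y).trans (le_max_right _ _)) (fun g hg hgc => ?_) hψ
  have hgi : ∀ i, ContDiff ℝ ∞ fun y => g y i := fun i => by fun_prop
  have hgic : ∀ i, HasCompactSupport fun y => g y i := fun i =>
    hgc.comp_left (g := fun z : WeakGradient.Eu d => z i) rfl
  -- the field `g` is split into its components along the standard basis
  have hsum : ∀ H : WeakGradient.Eu d → WeakGradient.Eu d,
      AEStronglyMeasurable H (volume.restrict Ω) →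
      (∀ᵐ y ∂volume.restrict Ω, ‖H y‖ ≤ max (L * θ) L) →
      ∫ y in Ω, inner ℝ (H y) (g y)
        = ∑ i, ∫ y in Ω, inner ℝ (H y) (g y i • EuclideanSpace.single i (1 : ℝ)) := by
    intro H hHm hH
    rw [← integral_finsetSum]
    · refine integral_congr_ae (Eventually.of_forall fun y => ?_)
      simp only [← inner_sum]
      congr 1
      ext j
      simp [Finset.sum_apply, Pi.single_apply]
    · intro i _
      have h1 : Integrable (fun y => g y i • EuclideanSpace.single i (1 : ℝ))
          (volume.restrict Ω) :=
        (((hgi i).continuous.integrable_of_hasCompactSupport (hgic i)).smul_const _).integrableOn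
      refine (h1.norm.const_mul (max (L * θ) L)).mono'
        (hHm.inner h1.aestronglyMeasurable) ?_
      filter_upwards [hH] with y hy
      exact (norm_inner_le_norm _ _).trans (by gcongr)
  rw [hsum _ hgrad.aestronglyMeasurable
    (Eventually.of_forall fun y => (hgradL y).trans (le_max_right _ _))]
  simp only [fun m => hsum _ (hmeas m)
    ((hbd m).mono fun y hy => hy.trans (le_max_left _ _))]
  refine tendsto_finsetSum _ fun i _ => ?_
  exact WeakGradient.tendsto_setIntegral_inner_smul hΩ.isOpen hΩ.isBounded M D x hx hsize θ hθ
    hφ hφc hφΩ (hgi i) (hgic i) (by simp)
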